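/- Let $N=N_{3,2}=\mathbb R^3_x\times\mathbb R^3_y$ be the free two-step nilpotent Lie group on three generators, with law $(x,y)(x',y')=(x+x',\,y+y'+\tfrac12 x\wedge x')$, on which $K=SO(3)$ acts by $k\cdot(x,y)=(kx,ky)$. Let $N'=\mathbb R^3_x\times\mathbb R_t$ be its quotient by the central subgroup $\mathbb R^2_{(y_1,y_2)}$, with law $(x,t)(x',t')=(x+x',\,t+t'+\tfrac12[x\wedge x']_3)$, and let $K'\subset SO(3)$ be the stabiliser of the plane $\mathbb R^2_{(y_1,y_2)}\subset\mathbb R^3_y$, acting on $N'$ by the induced action. Let $\mathcal S(N)^K$ and $\mathcal S(N')^{K'}$ be the spaces of complex-valued invariant Schwartz functions. For $F\in\mathcal S(N)$ put $$\mathcal R F(x,t)=\int_{\mathbb R^2}F\big(x,(y_1,y_2,t)\big)\,dy_1\,dy_2 ,$$ and for $G\in\mathcal S(N')$ put $$\mathcal F_tG(x,\hat t)=\int_{\mathbb R}G(x,t)e^{-it\hat t}\,dt,\qquad \mathcal F_{x,t}G(\hat x,\hat t)=\int_{\mathbb R^3\times\mathbb R}G(x,t)e^{-ix\cdot\hat x}e^{-it\hat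 t}\,dx\,dt .$$ For a $K'$-invariant function $h$ on $\mathbb R^3\times\mathbb R$ and for $x,y\in\mathbb R^3$ with $y\neq0$, put $\mathrm{Radial}(h)(x,y)=h(k^{-1}x,t)$, where $y=k(0,0,t)$ with $k\in SO(3)$ and $t\in\mathbb R$ (this does not depend on the choice of $(k,t)$). A smooth $K'$-invariant function $g$ on $\mathbb R^3\times\mathbb R$ is said to satisfy Property (R) if for every $M\in\mathbb N$, with $Q_M^{(g)}(x,t)=\frac1{M!}\,\partial_t^Mg(x,0)\,t^M$, the function $\mathrm{Radial}(Q_M^{(g)})$ extends from $\mathbb R^3\times(\mathbb R^3\setminus\{0\})$ to a smooth function on $\mathbb R^3\times\mathbb R^3$ which is a homogeneous polynomial of degree $M$ in $y$ with coefficients smooth in $x$. Then, for every $G\in\mathcal S(N')^{K'}$, the following three conditions are equivalent: - $G\in\mathcal R(\mathcal S(N)^K)$, i.e. $G=\mathcal RF$ for some $F\in\mathcal S(N)^K$; - (i) $\mathcal F_tG$ satisfies Property (R); - (ii) $\mathcal F_{x,t}G$ satisfies Property (R). -/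

import Mathlib

open scoped ContDiff SchwartzMap

noncomputable section

namespace FreeNilpotent

/-- Euclidean space `ℝ³`. -/
abbrev E3 : Type := EuclideanSpace ℝ (Fin 3)

/-- The rotation group `K = SO(3)`. -/
abbrev SO3 : Type := Matrix.specialOrthogonalGroup (Fin 3) ℝ

/-- The standard action of `SO(3)` on `ℝ³`. -/
def rot (k : SO3) (x : E3) : E3 := WithLp.toLp 2 (k.1.mulVec x.ofLp)

theorem rot_one (x : E3) : rot 1 x = x := by simp [rot]

theorem rot_mul (k l : SO3) (x : E3) : rot (k * l) x = rot k (rot l x) := by simp [rot]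

theorem rot_inv_rot (k : SO3) (x : E3) : rot k⁻¹ (rot k x) = x := by
  rw [← rot_mul, inv_mul_cancel, rot_one]

theorem rot_rot_inv (k : SO3) (x : E3) : rot k (rot k⁻¹ x) = x := by
  rw [← rot_mul, mul_inv_cancel, rot_one]

/-- The underlying space `ℝ³ₓ × ℝ³_y` of `N = N_{3,2}` (exponential coordinates, so also its Lie
algebra). -/
abbrev N : Type := E3 × E3

/-- The underlying space `ℝ³ₓ × ℝ_t` of `N'` (and of its Lie algebra). -/
abbrev N' : Type := E3 × ℝ

/-- The vector (wedge) product on `ℝ³`. -/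
def wedge (x y : E3) : E3 := WithLp.toLp 2 (crossProduct x.ofLp y.ofLp)

/-- The group law of `N_{3,2}`: `(x, y)(x', y') = (x + x', y + y' + ½ x ∧ x')`. -/
def mulN (p q : N) : N := (p.1 + q.1, p.2 + q.2 + (1 / 2 : ℝ) • wedge p.1 q.1)

/-- The group law of `N'`: `(x, t)(x', t') = (x + x', t + t' + ½ [x ∧ x']₃)`. -/
def mulN' (p q : N') : N' := (p.1 + q.1, p.2 + q.2 + (1 / 2 : ℝ) * wedge p.1 q.1 2)

/-- The quotient map `N → N'`, `(x, y) ↦ (x, y₃)`. -/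
def quot (p : N) : N' := (p.1, p.2 2)

theorem quot_mulN (p q : N) : quot (mulN p q) = mulN' (quot p) (quot q) := by
  simp [quot, mulN, mulN']

/-- The inclusion `(x, t) ↦ (x, (0, 0, t))`, a section of `quot`; it identifies (the Lie algebra
of) `N'` with a subspace of (the Lie algebra of) `N`. -/
def incl (p : N') : N := (p.1, !₂[0, 0, p.2])

theorem quot_incl (p : N') : quot (incl p) = p := by simp [quot, incl]

/-- The plane `ℝ²_{(y₁, y₂)}` in `ℝ³_y`. -/
def plane : Set E3 := {y | y 2 = 0}

/-- `K'`, the stabiliser of the plane `ℝ²_{(y₁, y₂)}` in `SO(3)`. -/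
def K' : Subgroup SO3 where
  carrier := {k | rot k '' plane = plane}
  one_mem' := by
    change rot 1 '' plane = plane
    simp [funext rot_one]
  mul_mem' := by
    intro k l (hk : rot k '' plane = plane) (hl : rot l '' plane = plane)
    change rot (k * l) '' plane = plane
    rw [funext (rot_mul k l), ← Function.comp_def, Set.image_comp, hl, hk]
  inv_mem' := by
    intro k (hk : rot k '' plane = plane)
    change rot k⁻¹ '' plane = plane
    conv_lhs => rw [← hk]
    rw [← Set.image_comp, Function.comp_def, funext (rot_inv_rot k), Set.image_id']

/-- The diagonal action of `SO(3)` on `N`. -/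
def actN (k : SO3) (p : N) : N := (rot k p.1, rot k p.2)

/-- The action on `N'` (for `k ∈ K'`) induced from that on `N` by passing to the quotient. -/
def actN' (k : SO3) (p : N') : N' := quot (actN k (incl p))

/-- `K`-invariance of a function on `N`. -/
def IsKInvariant (F : N → ℂ) : Prop := ∀ (k : SO3) (p : N), F (actN k p) = F p

/-- `K'`-invariance of a function on `N'`. -/
def IsK'Invariant (G : N' → ℂ) : Prop := ∀ k ∈ K', ∀ p : N', G (actN' k p) = G p

/-- `ℛ F`: integration of `F` over the cosets of the central subgroup
`{(0, (a, b, 0))} = ℝ²_{(y₁, y₂)}` of `N`. -/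
def fibreIntegral (F : N → ℂ) (p : N') : ℂ :=
  ∫ z : ℝ × ℝ, F (mulN (incl p) (0, !₂[z.1, z.2, 0]))

theorem fibreIntegral_apply (F : N → ℂ) (x : E3) (t : ℝ) :
    fibreIntegral F (x, t) = ∫ z : ℝ × ℝ, F (x, !₂[z.1, z.2, t]) := by
  unfold fibreIntegral
  congr 1
  funext z
  congr 1
  refine Prod.ext (by simp [mulN, incl]) ?_
  ext i
  fin_cases i <;> simp [mulN, incl, wedge]

/-- The partial Fourier transform `ℱ_t`. -/
def fourierT (G : N' → ℂ) (p : N') : ℂ :=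
  ∫ t : ℝ, G (p.1, t) * Complex.exp (-(Complex.I * ((t * p.2 : ℝ) : ℂ)))

/-- The full Fourier transform `ℱ_{x,t}`. -/
def fourierXT (G : N' → ℂ) (p : N') : ℂ :=
  ∫ q : N', G q * Complex.exp (-(Complex.I * ((inner ℝ q.1 p.1 : ℝ) : ℂ)))
    * Complex.exp (-(Complex.I * ((q.2 * p.2 : ℝ) : ℂ)))

/-- `Q_M^{(g)}(x, t) = (1 / M!) ∂_t^M g(x, 0) t^M`. -/
def taylorTerm (g : N' → ℂ) (M : ℕ) (p : N') : ℂ :=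
  (1 / (M.factorial : ℂ)) * iteratedDeriv M (fun t : ℝ => g (p.1, t)) 0 * (p.2 : ℂ) ^ M

open Classical in
/-- `Radial h (x, y) = h (k⁻¹ x, t)` where `y = k (0, 0, t)` for some `k ∈ K`. For `K'`-invariant
`h` and `y ≠ 0` this is independent of the choice of `(k, t)`. -/
def Radial (h : N' → ℂ) (p : N) : ℂ :=
  if H : ∃ kt : SO3 × ℝ, p.2 = rot kt.1 !₂[0, 0, kt.2] then
    h (rot H.choose.1⁻¹ p.1, H.choose.2)
  else 0

theorem rot_apply (k : SO3) (x : E3) (i : Fin 3) :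
    rot k x i = k.1 i 0 * x 0 + k.1 i 1 * x 1 + k.1 i 2 * x 2 := by
  simp [rot, Matrix.mulVec, dotProduct, Fin.sum_univ_three]

theorem mem_K' (k : SO3) (h0 : k.1 0 2 = 0) (h1 : k.1 1 2 = 0) : k ∈ K' := by
  have ho := (Matrix.mem_specialOrthogonalGroup_iff.1 k.2).1
  have h1' : k.1.transpose * k.1 = 1 := (Matrix.mem_orthogonalGroup_iff' _ _).1 ho
  have a := congrFun (congrFun h1' 2) 2
  have b := congrFun (congrFun h1' 2) 0
  have c := congrFun (congrFun h1' 2) 1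
  simp [Matrix.mul_apply, Fin.sum_univ_three, h0, h1] at a b c
  have hne : k.1 2 2 ≠ 0 := by intro h; simp [h] at a
  have b' := b.resolve_left hne
  have c' := c.resolve_left hne
  have key : ∀ y : E3, rot k y ∈ plane ↔ y ∈ plane := by
    intro y
    change rot k y 2 = 0 ↔ y 2 = 0
    simp [rot_apply, b', c', hne]
  change rot k '' plane = plane
  ext y
  constructor
  · rintro ⟨z, hz, rfl⟩; exact (key z).2 hz
  · intro hy; exact ⟨rot k⁻¹ y, (key _).1 (by rwa [rot_rot_inv]), rot_rot_inv k y⟩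

/-- `Radial h` does not depend on the choice of `(k, t)` where `y ≠ 0`. -/
theorem Radial_apply (h : N' → ℂ) (hh : IsK'Invariant h) (x : E3) (k : SO3) (t : ℝ)
    (ht : t ≠ 0) : Radial h (x, rot k !₂[0, 0, t]) = h (rot k⁻¹ x, t) := by
  have H : ∃ kt : SO3 × ℝ, rot k !₂[0, 0, t] = rot kt.1 !₂[0, 0, kt.2] := ⟨(k, t), rfl⟩
  unfold Radial
  rw [dif_pos H]
  have hs := H.choose_spec
  generalize H.choose = q at hs
  obtain ⟨l, s⟩ := q
  have e : (!₂[0, 0, s] : E3) = rot (l⁻¹ * k) !₂[0, 0, t] := by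
    rw [rot_mul, hs, rot_inv_rot]
  have e' := fun i => congrArg (fun v : E3 => v i) e
  simp only [rot_apply] at e'
  have e0 := e' 0
  have e1 := e' 1
  simp [ht] at e0 e1
  have hm := mem_K' (l⁻¹ * k) (by simpa using e0) (by simpa using e1)
  have := hh _ hm (rot k⁻¹ x, t)
  simp only [← this]
  unfold actN' quot incl actN
  simp only [← e, rot_mul, rot_rot_inv]
  simp

theorem matrix_mem {a b c r : ℝ} (hr : r ^ 2 = a ^ 2 + b ^ 2 + c ^ 2) (hrn : r ≠ 0)
    (hdn : r + c ≠ 0) :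
    !![a ^ 2 / (r * (r + c)) - 1, a * b / (r * (r + c)), a / r;
       a * b / (r * (r + c)), b ^ 2 / (r * (r + c)) - 1, b / r;
       a / r, b / r, c / r] ∈ Matrix.specialOrthogonalGroup (Fin 3) ℝ := by
  rw [Matrix.mem_specialOrthogonalGroup_iff]
  constructor
  · rw [Matrix.mem_orthogonalGroup_iff]
    ext i j
    fin_cases i <;> fin_cases j <;> simp [Matrix.mul_apply, Fin.sum_univ_three] <;>
      field_simp <;> grind
  · rw [Matrix.det_fin_three]
    simp
    field_simp
    grind

/-- Every `y` is of the form `k (0, 0, t)`. -/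
theorem exists_rot (y : E3) : ∃ kt : SO3 × ℝ, y = rot kt.1 !₂[0, 0, kt.2] := by
  obtain ⟨r, hr0, hr⟩ : ∃ r : ℝ, 0 ≤ r ∧ r ^ 2 = y 0 ^ 2 + y 1 ^ 2 + y 2 ^ 2 :=
    ⟨√(y 0 ^ 2 + y 1 ^ 2 + y 2 ^ 2), by positivity, Real.sq_sqrt (by positivity)⟩
  by_cases hd : r * (r + y 2) = 0
  · have : y 0 ^ 2 + y 1 ^ 2 = 0 := by
      rcases mul_eq_zero.1 hd with h | h
      · subst h; nlinarith [sq_nonneg (y 0), sq_nonneg (y 1), sq_nonneg (y 2)]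
      · have : r = - y 2 := by linarith
        subst this; linarith
    have h0 : y 0 = 0 := by nlinarith [sq_nonneg (y 0), sq_nonneg (y 1)]
    have h1 : y 1 = 0 := by nlinarith [sq_nonneg (y 0), sq_nonneg (y 1)]
    refine ⟨(1, y 2), ?_⟩
    ext i; fin_cases i <;> simp [rot_one, h0, h1]
  · have hrn : r ≠ 0 := left_ne_zero_of_mul hd
    have hdn : r + y 2 ≠ 0 := right_ne_zero_of_mul hd
    refine ⟨(⟨_, matrix_mem hr hrn hdn⟩, r), ?_⟩
    ext i
    rw [rot_apply]
    fin_cases i <;> simp <;> field_simp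

/-- `P` is, as a function of `y`, a homogeneous polynomial of degree `M`, with coefficients that
are smooth functions of `x`. -/
def IsHomogeneousPolyInY (M : ℕ) (P : N → ℂ) : Prop :=
  ∃ c : (Fin 3 → ℕ) → E3 → ℂ, (∀ α, ContDiff ℝ ∞ (c α)) ∧
    ∀ (x y : E3), P (x, y) =
      ∑ α ∈ Finset.piAntidiag (Finset.univ : Finset (Fin 3)) M,
        c α x * ∏ i, (y i : ℂ) ^ α i

/-- Property (R): for every `M`, `Radial (Q_M^{(g)})`, on `ℝ³ × (ℝ³ \ {0})`, extends to a smooth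
function on `ℝ³ × ℝ³` that is a homogeneous polynomial of degree `M` in `y`, with smooth
coefficients in `x`. -/
def PropertyR (g : N' → ℂ) : Prop :=
  ∀ M : ℕ, ∃ P : N → ℂ, ContDiff ℝ ∞ P ∧ IsHomogeneousPolyInY M P ∧
    ∀ (x y : E3), y ≠ 0 → P (x, y) = Radial (taylorTerm g M) (x, y)

end FreeNilpotent

end

open FreeNilpotent

/-! Write `g = ℱ_{x,t} G`. Integrating over the fibre corresponds, under the full Fourier
transforms, to restricting to the frequencies `(ξ, axis s)` (`prodFT_fibreIntegralS`). Since
`prodFT` is bijective on Schwartz functions and commutes with isometries, `G` is in the image of `ℛ`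
iff `g` is the restriction of a `K`-invariant Schwartz function `H` on `N`
(`exists_fibreIntegral_iff`).

If `H` exists, its Taylor polynomial of degree `M` in `y` at `y = 0` is by invariance the radial
extension of the `t^M` term of `g`; this is (R) (`propertyR_of_extension`).

Conversely, `H` can only be `Radial g`, and the task is to show that this is Schwartz
(`exists_schwartz_extension`). Off `{y = 0}` smoothness comes from local sections of `SO(3) → S²`.
Near `{y = 0}` the Taylor terms of order `< m` are split off: by (R) their radial extensions are
polynomials in `y`. The remainder is flat of order `m` at `t = 0`, and `j` derivatives of its radial
extension cost at most a further `‖y‖^(-j)` (`exists_radial_bound`), so for `m ≥ 2j + 2` they are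
`O(‖y‖²)` (`radial_flat_estimate`) and `contDiff_of_flat` applies. As the extension is forced, `m`
may depend on the order of differentiability being proved, and no Borel summation is needed.

For (i) ⇔ (ii), the Taylor coefficients of `ℱ_t G` are the moments of `G` in `t`, and those of
`ℱ_{x,t} G` are the Fourier transforms of these moments (`taylorCoeff_fourierXT`). Once the
coefficients in (R) are known to be Schwartz (`propertyR_iff`), (R) is a family of linear identities
between rotated Schwartz functions, and the Fourier transform in `x` preserves it
(`isRadialPoly_angFT`). -/

noncomputable section

namespace FreeNilpotent

open MeasureTheory

universe u

/-! ### Differentiability across `{y = 0}` of flat functions. -/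

section Analysis

variable {E F V : Type u} [NormedAddCommGroup E] [NormedSpace ℝ E]
  [NormedAddCommGroup F] [NormedSpace ℝ F] [NormedAddCommGroup V] [NormedSpace ℝ V]

/-- At a point with `p.2 = 0` the increment in the direction `h` is `f (p + h)` itself, which is
`O(‖h.2‖²)` and hence `o(‖h‖)`. -/
theorem hasFDerivAt_zero_of_norm_le_sq {f : E × F → V} (h0 : ∀ p, p.2 = 0 → f p = 0) {C : ℝ}
    (hC : ∀ p : E × F, p.2 ≠ 0 → ‖p.2‖ ≤ 1 → ‖f p‖ ≤ C * ‖p.2‖ ^ 2) {p : E × F} (hp : p.2 = 0) :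
    HasFDerivAt f (0 : E × F →L[ℝ] V) p := by
  rw [hasFDerivAt_iff_isLittleO_nhds_zero]
  have hC' : ∀ q : E × F, ‖q.2‖ ≤ 1 → ‖f q‖ ≤ |C| * ‖q.2‖ ^ 2 := by
    intro q hq
    by_cases h : q.2 = 0
    · simp [h0 q h]; positivity
    · exact (hC q h hq).trans (by gcongr; exact le_abs_self C)
  have h1 : (fun h : E × F => f (p + h) - f p - (0 : E × F →L[ℝ] V) h) =O[nhds 0]
      fun h => ‖h‖ ^ 2 := by
    refine Asymptotics.IsBigO.of_bound |C| ?_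
    filter_upwards [Metric.ball_mem_nhds (0 : E × F) one_pos] with h hh
    have h2 : ‖h.2‖ ≤ ‖h‖ := norm_snd_le h
    have : ‖h.2‖ ≤ 1 := h2.trans (by simpa using (mem_ball_zero_iff.1 hh).le)
    have h3 := hC' (p + h) (by simpa [hp] using this)
    simp only [h0 p hp, zero_apply, sub_zero, Prod.snd_add, hp, zero_add] at h3 ⊢
    refine h3.trans ?_
    rw [Real.norm_of_nonneg (by positivity)]
    gcongr
  refine h1.trans_isLittleO ?_
  simpa using (Asymptotics.isLittleO_norm_pow_id (E' := E × F) one_lt_two)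

/-- A function on `E × F` that is smooth off `{y = 0}`, vanishes on `{y = 0}`, and whose derivatives
up to order `n` are `O(‖y‖²)`, is of class `C^n`. -/
theorem contDiff_of_flat (n : ℕ) : ∀ {V : Type u} [NormedAddCommGroup V] [NormedSpace ℝ V]
    {f : E × F → V}, (∀ p, p.2 = 0 → f p = 0) → (∀ p : E × F, p.2 ≠ 0 → ContDiffAt ℝ ∞ f p) →
    (∀ j ≤ n, ∃ C : ℝ, ∀ p : E × F, p.2 ≠ 0 → ‖p.2‖ ≤ 1 →
      ‖iteratedFDeriv ℝ j f p‖ ≤ C * ‖p.2‖ ^ 2) → ContDiff ℝ n f := by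
  have hd : ∀ {V : Type u} [NormedAddCommGroup V] [NormedSpace ℝ V]
    {f : E × F → V}, (∀ p, p.2 = 0 → f p = 0) → (∀ p : E × F, p.2 ≠ 0 → ContDiffAt ℝ ∞ f p) →
    (∃ C : ℝ, ∀ p : E × F, p.2 ≠ 0 → ‖p.2‖ ≤ 1 →
      ‖iteratedFDeriv ℝ 0 f p‖ ≤ C * ‖p.2‖ ^ 2) →
      Differentiable ℝ f ∧ ∀ p : E × F, p.2 = 0 → fderiv ℝ f p = 0 := by
    intro V _ _ f h0 h1 ⟨C, hC⟩
    simp only [norm_iteratedFDeriv_zero] at hC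
    refine ⟨fun p => ?_, fun p hp => (hasFDerivAt_zero_of_norm_le_sq h0 hC hp).fderiv⟩
    by_cases hp : p.2 = 0
    · exact (hasFDerivAt_zero_of_norm_le_sq h0 hC hp).differentiableAt
    · exact (h1 p hp).differentiableAt (by simp)
  induction n with
  | zero =>
    intro V _ _ f h0 h1 h2
    exact contDiff_zero.2 (hd h0 h1 (h2 0 le_rfl)).1.continuous
  | succ n ih =>
    intro V _ _ f h0 h1 h2
    obtain ⟨ha, hb⟩ := hd h0 h1 (h2 0 (by simp))
    have : ContDiff ℝ ((n : ℕ∞ω) + 1) f := by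
      -- By `hb` the derivative vanishes on `{y = 0}` too, so it satisfies the induction hypothesis
      -- one order lower, with a new target space.
      rw [contDiff_succ_iff_fderiv]
      refine ⟨ha, by simp, ih hb (fun p hp => (h1 p hp).fderiv_right (by simp)) ?_⟩
      intro j hj
      obtain ⟨C, hC⟩ := h2 (j + 1) (by omega)
      exact ⟨C, fun p hp hp' => by rw [norm_iteratedFDeriv_fderiv]; exact hC p hp hp'⟩
    exact_mod_cast this

/-- The derivative in the last variable of a function on `E × ℝ`. -/
def sndDeriv {E V : Type*} [NormedAddCommGroup E] [NormedSpace ℝ E] [NormedAddCommGroup V]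
    [NormedSpace ℝ V] (f : E × ℝ → V) (p : E × ℝ) : V := fderiv ℝ f p (0, 1)

end Analysis

/-! ### Functions vanishing to finite order on `{t = 0}`. -/

section Taylor

variable {E V : Type} [NormedAddCommGroup E] [NormedSpace ℝ E]
  [NormedAddCommGroup V] [NormedSpace ℝ V]

theorem contDiff_fderiv_infty {f : E → V} (hf : ContDiff ℝ ∞ f) : ContDiff ℝ ∞ (fderiv ℝ f) :=
  hf.fderiv_right (by simp)

theorem contDiff_sndDeriv {f : E × ℝ → V} (hf : ContDiff ℝ ∞ f) : ContDiff ℝ ∞ (sndDeriv f) :=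
  (contDiff_fderiv_infty hf).clm_apply contDiff_const

theorem contDiff_sndDeriv_iterate {f : E × ℝ → V} (hf : ContDiff ℝ ∞ f) (j : ℕ) :
    ContDiff ℝ ∞ (sndDeriv^[j] f) := by
  induction j generalizing f with
  | zero => exact hf
  | succ j ih => exact ih (contDiff_sndDeriv hf)

theorem sndDeriv_fderiv {f : E × ℝ → V} (hf : ContDiff ℝ ∞ f) :
    sndDeriv (fderiv ℝ f) = fderiv ℝ (sndDeriv f) := by
  ext1 p
  have hs : IsSymmSndFDerivAt ℝ f p := hf.contDiffAt.isSymmSndFDerivAt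
    (by simpa using WithTop.coe_le_coe.2 (le_top : (2 : ℕ∞) ≤ ⊤))
  have h1 : DifferentiableAt ℝ (fderiv ℝ f) p :=
    (contDiff_fderiv_infty hf).differentiable (by simp) p
  refine ContinuousLinearMap.ext fun v => ?_
  change fderiv ℝ (fderiv ℝ f) p (0, 1) v = fderiv ℝ (fun q => fderiv ℝ f q (0, 1)) p v
  rw [fderiv_clm_apply h1 (differentiableAt_const _)]
  simp [hs.eq]

theorem sndDeriv_iterate_fderiv {f : E × ℝ → V} (hf : ContDiff ℝ ∞ f) (j : ℕ) :
    sndDeriv^[j] (fderiv ℝ f) = fderiv ℝ (sndDeriv^[j] f) := by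
  induction j generalizing f with
  | zero => rfl
  | succ j ih =>
    rw [Function.iterate_succ_apply, Function.iterate_succ_apply, sndDeriv_fderiv hf,
      ih (contDiff_sndDeriv hf)]

theorem iteratedDeriv_eq_sndDeriv_iterate {f : E × ℝ → V} (hf : ContDiff ℝ ∞ f) (j : ℕ) (x : E) :
    iteratedDeriv j (fun t => f (x, t)) = fun t => (sndDeriv^[j] f) (x, t) := by
  induction j generalizing f with
  | zero => simp
  | succ j ih =>
    rw [iteratedDeriv_succ', Function.iterate_succ_apply, ← ih (contDiff_sndDeriv hf)]
    congr 1
    ext t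
    have h1 : HasFDerivAt f (fderiv ℝ f (x, t)) (x, t) :=
      (hf.differentiable (by simp) _).hasFDerivAt
    have h2 : HasDerivAt (fun t : ℝ => (x, t)) ((0 : E), (1 : ℝ)) t :=
      (hasDerivAt_const t x).prodMk (hasDerivAt_id t)
    exact (h1.comp_hasDerivAt t h2).deriv

/-- Only derivatives in `t` need checking, because those tangent to `{t = 0}` vanish along with the
function. The induction passes to `fderiv ℝ f`, which loses one order of vanishing: its component
along `(0, 1)` uses one more derivative in `t`. -/
theorem iteratedFDeriv_eq_zero_of_sndDeriv (i : ℕ) : ∀ {V : Type} [NormedAddCommGroup V]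
    [NormedSpace ℝ V] {f : E × ℝ → V} {m : ℕ}, ContDiff ℝ ∞ f →
    (∀ j < m, ∀ x, (sndDeriv^[j] f) (x, 0) = 0) → i < m → ∀ x, iteratedFDeriv ℝ i f (x, 0) = 0 := by
  induction i with
  | zero =>
    intro V _ _ f m hf h hi x
    rw [← norm_eq_zero, norm_iteratedFDeriv_zero, norm_eq_zero]
    exact h 0 hi x
  | succ i ih =>
    intro V _ _ f m hf h hi x
    rw [← norm_eq_zero, ← norm_iteratedFDeriv_fderiv, norm_eq_zero]
    refine ih (m := m - 1) (contDiff_fderiv_infty hf) (fun j hj x => ?_) (by omega) x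
    rw [sndDeriv_iterate_fderiv hf]
    have hu := contDiff_sndDeriv_iterate hf j
    have h1 := h j (by omega)
    have h2 : fderiv ℝ (sndDeriv^[j] f) (x, 0) (0, 1) = 0 := by
      have := h (j + 1) (by omega) x
      rwa [Function.iterate_succ_apply'] at this
    have h3 : (fderiv ℝ (sndDeriv^[j] f) (x, 0)).comp (ContinuousLinearMap.inl ℝ E ℝ) = 0 := by
      have h4 : HasFDerivAt (sndDeriv^[j] f) (fderiv ℝ (sndDeriv^[j] f) (x, 0))
          (ContinuousLinearMap.inl ℝ E ℝ x) := (hu.differentiable (by simp) _).hasFDerivAt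
      have h5 := h4.comp x (ContinuousLinearMap.inl ℝ E ℝ).hasFDerivAt
      have h6 : sndDeriv^[j] f ∘ (ContinuousLinearMap.inl ℝ E ℝ) = fun _ => 0 := by
        ext x; exact h1 x
      rw [h6] at h5
      exact h5.unique (hasFDerivAt_const _ _)
    refine ContinuousLinearMap.ext fun ⟨a, b⟩ => ?_
    have e : ((a, b) : E × ℝ) = ContinuousLinearMap.inl ℝ E ℝ a + b • ((0 : E), (1 : ℝ)) := by
      simp
    have h7 := congrArg (fun L => L a) h3
    simp only [ContinuousLinearMap.comp_apply] at h7
    rw [e, map_add, map_smul, h2, h7]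
    simp

/-- Taylor estimate: if the derivatives of order `< m` vanish on `t = 0`, the `i`-th derivative is
`O(|t|^(m-i))`. -/
theorem norm_iteratedFDeriv_le_of_flat {f : E × ℝ → V} {m : ℕ} (hf : ContDiff ℝ ∞ f)
    (h : ∀ i < m, ∀ x, iteratedFDeriv ℝ i f (x, 0) = 0) {x : E} {B : ℝ}
    (hB : ∀ s : ℝ, |s| ≤ 1 → ‖iteratedFDeriv ℝ m f (x, s)‖ ≤ B) {i : ℕ} (hi : i ≤ m) {t : ℝ}
    (ht : |t| ≤ 1) : ‖iteratedFDeriv ℝ i f (x, t)‖ ≤ B * |t| ^ (m - i) := by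
  obtain ⟨d, rfl⟩ := Nat.exists_eq_add_of_le hi
  have hB0 : 0 ≤ B := (norm_nonneg _).trans (hB 0 (by simp))
  rw [Nat.add_sub_cancel_left]
  induction d generalizing i t with
  | zero => simpa using hB t ht
  | succ d ih =>
    -- The mean value inequality is used on the slice over a single `x`, so `B` may depend on `x`;
    -- this is how decay in `x` survives the estimate.
    have key : ∀ p ∈ ({x} : Set E) ×ˢ Metric.closedBall (0 : ℝ) |t|,
        ‖fderiv ℝ (iteratedFDeriv ℝ i f) p‖ ≤ B * |t| ^ d := by
      rintro ⟨x', s⟩ ⟨hx', hs⟩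
      simp only [Set.mem_singleton_iff, mem_closedBall_zero_iff, Real.norm_eq_abs] at hx' hs
      subst hx'
      rw [norm_fderiv_iteratedFDeriv]
      have e : i + 1 + d = i + (d + 1) := by ring
      refine (ih (i := i + 1) (hs.trans ht) (by rwa [e]) (by rwa [e]) (by omega)).trans ?_
      gcongr
    have hc : Convex ℝ (({x} : Set E) ×ˢ Metric.closedBall (0 : ℝ) |t|) :=
      (convex_singleton x).prod (convex_closedBall _ _)
    have h1 := hc.norm_image_sub_le_of_norm_fderiv_le (𝕜 := ℝ) (f := iteratedFDeriv ℝ i f)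
      (fun p _ => (hf.differentiable_iteratedFDeriv (by exact_mod_cast ENat.natCast_lt_top i)) p) key
      (x := (x, 0)) (y := (x, t)) (by simp) (by simp)
    rw [h i (by omega) x, sub_zero] at h1
    refine h1.trans_eq ?_
    simp [pow_succ, mul_assoc]

end Taylor

/-! ### Rapid decay in `x`, locally uniformly in `y`. -/

section XDecay

variable {E F V : Type*} [NormedAddCommGroup E] [NormedSpace ℝ E]
  [NormedAddCommGroup F] [NormedSpace ℝ F] [NormedAddCommGroup V] [NormedSpace ℝ V]

/-- Smooth functions on `E × F` all of whose derivatives decay rapidly in the first variable,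
uniformly for the second variable in the unit ball. -/
structure XDecay (f : E × F → V) : Prop where
  contDiff : ContDiff ℝ ∞ f
  decay : ∀ k j : ℕ, ∃ C : ℝ, ∀ (x : E) (y : F), ‖y‖ ≤ 1 →
    ‖x‖ ^ k * ‖iteratedFDeriv ℝ j f (x, y)‖ ≤ C

theorem xDecay_schwartz (f : 𝓢(E × F, V)) : XDecay (f : E × F → V) := by
  refine ⟨f.smooth _, fun k j => ?_⟩
  obtain ⟨C, -, hC⟩ := f.decay k j
  refine ⟨C, fun x y _ => le_trans ?_ (hC (x, y))⟩
  gcongr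
  exact norm_fst_le (x, y)

theorem XDecay.add {f g : E × F → V} (hf : XDecay f) (hg : XDecay g) : XDecay (f + g) := by
  refine ⟨hf.contDiff.add hg.contDiff, fun k j => ?_⟩
  obtain ⟨C, hC⟩ := hf.decay k j
  obtain ⟨D, hD⟩ := hg.decay k j
  refine ⟨C + D, fun x y hy => ?_⟩
  rw [iteratedFDeriv_add_apply
    (hf.contDiff.of_le (by exact_mod_cast le_top)).contDiffAt
    (hg.contDiff.of_le (by exact_mod_cast le_top)).contDiffAt]
  calc _ ≤ ‖x‖ ^ k * (‖iteratedFDeriv ℝ j f (x, y)‖ + ‖iteratedFDeriv ℝ j g (x, y)‖) := by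
        gcongr; exact norm_add_le _ _
    _ ≤ C + D := by rw [mul_add]; exact add_le_add (hC x y hy) (hD x y hy)

theorem XDecay.neg {f : E × F → V} (hf : XDecay f) : XDecay (-f) := by
  refine ⟨hf.contDiff.neg, fun k j => ?_⟩
  obtain ⟨C, hC⟩ := hf.decay k j
  refine ⟨C, fun x y hy => ?_⟩
  rw [iteratedFDeriv_neg_apply, norm_neg]
  exact hC x y hy

theorem XDecay.sum {ι : Type*} {s : Finset ι} {f : ι → E × F → V} (hf : ∀ i ∈ s, XDecay (f i)) :
    XDecay (∑ i ∈ s, f i) := by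
  classical
  induction s using Finset.induction_on with
  | empty =>
    refine ⟨contDiff_zero_fun, fun k j => ⟨0, fun x y _ => ?_⟩⟩
    have : iteratedFDeriv ℝ j (0 : E × F → V) = 0 := iteratedFDeriv_fun_zero
    simp [this]
  | insert i s hi ih =>
    rw [Finset.sum_insert hi]
    exact (hf i (by simp)).add (ih fun j hj => hf j (by simp [hj]))

theorem norm_iteratedFDeriv_comp_fst_le {f : E → V} (hf : ContDiff ℝ ∞ f) (j : ℕ) (p : E × F) :
    ‖iteratedFDeriv ℝ j (fun q : E × F => f q.1) p‖ ≤ ‖iteratedFDeriv ℝ j f p.1‖ := by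
  have h := (ContinuousLinearMap.fst ℝ E F).iteratedFDeriv_comp_right hf p (i := j)
    (by exact_mod_cast le_top)
  have e : (fun q : E × F => f q.1) = f ∘ (ContinuousLinearMap.fst ℝ E F) := rfl
  rw [e, h]
  refine (ContinuousMultilinearMap.norm_compContinuousLinearMap_le _ _).trans ?_
  refine mul_le_of_le_one_right (norm_nonneg _) ?_
  exact Finset.prod_le_one (fun _ _ => norm_nonneg _)
    fun _ _ => ContinuousLinearMap.norm_fst_le ℝ E F

theorem norm_iteratedFDeriv_comp_snd_le {f : F → V} (hf : ContDiff ℝ ∞ f) (j : ℕ) (p : E × F) :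
    ‖iteratedFDeriv ℝ j (fun q : E × F => f q.2) p‖ ≤ ‖iteratedFDeriv ℝ j f p.2‖ := by
  have h := (ContinuousLinearMap.snd ℝ E F).iteratedFDeriv_comp_right hf p (i := j)
    (by exact_mod_cast le_top)
  have e : (fun q : E × F => f q.2) = f ∘ (ContinuousLinearMap.snd ℝ E F) := rfl
  rw [e, h]
  refine (ContinuousMultilinearMap.norm_compContinuousLinearMap_le _ _).trans ?_
  refine mul_le_of_le_one_right (norm_nonneg _) ?_
  exact Finset.prod_le_one (fun _ _ => norm_nonneg _)
    fun _ _ => ContinuousLinearMap.norm_snd_le ℝ E F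

/-- Leibniz' rule, with the derivatives of `q` bounded by compactness of the unit ball. Decay is
demanded only for `‖y‖ ≤ 1` so that `q` may be a polynomial. -/
theorem XDecay.tensor [ProperSpace F] (a : 𝓢(E, ℂ)) {q : F → ℂ} (hq : ContDiff ℝ ∞ q) :
    XDecay (fun p : E × F => a p.1 * q p.2) := by
  have ha : ContDiff ℝ ∞ (fun p : E × F => a p.1) := (a.smooth ⊤).comp contDiff_fst
  have hq' : ContDiff ℝ ∞ (fun p : E × F => q p.2) := hq.comp contDiff_snd
  refine ⟨ha.mul hq', fun k j => ?_⟩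
  have hQ : ∀ i, ∃ C, ∀ y : F, ‖y‖ ≤ 1 → ‖iteratedFDeriv ℝ i q y‖ ≤ C := by
    intro i
    have hc : Continuous (iteratedFDeriv ℝ i q) :=
      hq.continuous_iteratedFDeriv (by exact_mod_cast le_top)
    obtain ⟨C, hC⟩ := (isCompact_closedBall (0 : F) 1).exists_bound_of_continuousOn hc.continuousOn
    exact ⟨C, fun y hy => hC y (by simpa using hy)⟩
  choose C hC using hQ
  choose D hD0 hD using fun i => a.decay k i
  refine ⟨∑ i ∈ Finset.range (j + 1), (j.choose i : ℝ) * D i * C (j - i), fun x y hy => ?_⟩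
  have h1 := norm_iteratedFDeriv_mul_le ha hq' (x, y) (n := j) (by exact_mod_cast le_top)
  refine (mul_le_mul_of_nonneg_left h1 (by positivity)).trans ?_
  · rw [Finset.mul_sum]
    refine Finset.sum_le_sum fun i _ => ?_
    calc _ = (j.choose i : ℝ) * (‖x‖ ^ k * ‖iteratedFDeriv ℝ i (fun p : E × F => a p.1) (x, y)‖)
          * ‖iteratedFDeriv ℝ (j - i) (fun p : E × F => q p.2) (x, y)‖ := by ring
      _ ≤ _ := by
        gcongr
        · exact mul_nonneg (by positivity) (hD0 i).le
        · refine le_trans ?_ (hD i x)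
          gcongr
          exact norm_iteratedFDeriv_comp_fst_le (a.smooth ⊤) i (x, y)
        · exact (norm_iteratedFDeriv_comp_snd_le hq _ (x, y)).trans (hC _ y hy)

end XDecay

/-! ### Integrating out a variable of a Schwartz function. -/

section Marginal

variable {E F V : Type} [NormedAddCommGroup E] [NormedSpace ℝ E]
  [NormedAddCommGroup F] [NormedSpace ℝ F] [NormedAddCommGroup V] [NormedSpace ℝ V]

/-- `(1 + ‖(x, y)‖)^(k + n)` dominates `‖x‖^k (1 + ‖y‖)^n`. With `n = μ.integrablePower` the right
side is an integrable majorant, uniform in `x`. -/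
theorem exists_bound_prod (f : 𝓢(E × F, V)) (k n : ℕ) :
    ∃ C : ℝ, ∀ x y, ‖x‖ ^ k * ‖f (x, y)‖ ≤ C * (1 + ‖y‖) ^ (-(n : ℝ)) := by
  have h := fun p => SchwartzMap.one_add_le_sup_seminorm_apply (𝕜 := ℝ) (m := (k + n, 0))
    (k := k + n) (n := 0) le_rfl le_rfl f p
  simp only [norm_iteratedFDeriv_zero] at h
  refine ⟨2 ^ (k + n) *
    ((Finset.Iic (k + n, 0)).sup fun m => SchwartzMap.seminorm ℝ m.1 m.2) f, fun x y => ?_⟩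
  rw [Real.rpow_neg (by positivity), Real.rpow_natCast, ← div_eq_mul_inv,
    le_div_iff₀ (by positivity)]
  refine le_trans ?_ (h (x, y))
  rw [pow_add, mul_right_comm]
  have h1 : ‖x‖ ≤ 1 + ‖(x, y)‖ := (norm_fst_le (x, y)).trans (by simp)
  have h2 : ‖y‖ ≤ ‖(x, y)‖ := norm_snd_le (x, y)
  gcongr

/-- The derivative in the first variable. -/
def fstDeriv (f : 𝓢(E × F, V)) : 𝓢(E × F, E →L[ℝ] V) :=
  (SchwartzMap.fderivCLM ℝ (E × F) V f).postcompCLM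
    ((ContinuousLinearMap.compL ℝ E (E × F) V).flip (ContinuousLinearMap.inl ℝ E F))

variable [MeasurableSpace F] [BorelSpace F] [SecondCountableTopology F]
  (μ : Measure F) [μ.HasTemperateGrowth]

theorem integrable_section (f : 𝓢(E × F, V)) (x : E) :
    Integrable (fun y => f (x, y)) μ := by
  obtain ⟨C, hC⟩ := exists_bound_prod f 0 μ.integrablePower
  refine ((μ.integrable_pow_neg_integrablePower).const_mul C).mono'
    (f.continuous.comp (by fun_prop)).aestronglyMeasurable ?_
  filter_upwards with y
  simpa using hC x y

/-- Dominated differentiation. The derivative is an integral of the same kind, of the Schwartz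
function `fstDeriv f`, so smoothness and decay follow by induction on the order. -/
theorem hasFDerivAt_integral_section (f : 𝓢(E × F, V)) (x : E) :
    HasFDerivAt (fun x => ∫ y, f (x, y) ∂μ) (∫ y, fstDeriv f (x, y) ∂μ) x := by
  obtain ⟨C, hC⟩ := exists_bound_prod (fstDeriv f) 0 μ.integrablePower
  refine hasFDerivAt_integral_of_dominated_of_fderiv_le (s := Set.univ) (Filter.univ_mem)
    (Filter.Eventually.of_forall fun x =>
      (integrable_section μ f x).aestronglyMeasurable)
    (integrable_section μ f x)
    (F' := fun x y => fstDeriv f (x, y))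
    (integrable_section μ (fstDeriv f) x).aestronglyMeasurable
    (bound := fun y => C * (1 + ‖y‖) ^ (-(μ.integrablePower : ℝ))) ?_
    ((μ.integrable_pow_neg_integrablePower).const_mul C) ?_
  · filter_upwards with y x _
    simpa using hC x y
  · filter_upwards with y x _
    have h1 : HasFDerivAt f (fderiv ℝ f (x, y)) (x, y) := f.differentiableAt.hasFDerivAt
    have h2 : HasFDerivAt (fun x : E => (x, y)) (ContinuousLinearMap.inl ℝ E F) x :=
      hasFDerivAt_prodMk_left x y
    exact h1.comp x h2

theorem contDiff_integral_section (n : ℕ) : ∀ {V : Type} [NormedAddCommGroup V] [NormedSpace ℝ V]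
    (f : 𝓢(E × F, V)), ContDiff ℝ n (fun x => ∫ y, f (x, y) ∂μ) := by
  induction n with
  | zero =>
    intro V _ _ f
    refine contDiff_zero.2 (continuous_iff_continuousAt.2 fun x =>
      (hasFDerivAt_integral_section μ f x).continuousAt)
  | succ n ih =>
    intro V _ _ f
    have : ContDiff ℝ ((n : ℕ∞ω) + 1) (fun x => ∫ y, f (x, y) ∂μ) := by
      rw [contDiff_succ_iff_fderiv]
      refine ⟨fun x => (hasFDerivAt_integral_section μ f x).differentiableAt, by simp, ?_⟩
      convert ih (fstDeriv f) using 1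
      ext1 x
      exact (hasFDerivAt_integral_section μ f x).fderiv
    exact_mod_cast this

theorem decay_integral_section (k j : ℕ) : ∀ {V : Type} [NormedAddCommGroup V] [NormedSpace ℝ V]
    (f : 𝓢(E × F, V)),
    ∃ C : ℝ, ∀ x, ‖x‖ ^ k * ‖iteratedFDeriv ℝ j (fun x => ∫ y, f (x, y) ∂μ) x‖ ≤ C := by
  induction j with
  | zero =>
    intro V _ _ f
    obtain ⟨C, hC⟩ := exists_bound_prod f k μ.integrablePower
    refine ⟨∫ y, C * (1 + ‖y‖) ^ (-(μ.integrablePower : ℝ)) ∂μ, fun x => ?_⟩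
    rw [norm_iteratedFDeriv_zero]
    calc _ = ‖∫ y, ‖x‖ ^ k • f (x, y) ∂μ‖ := by
          rw [integral_smul, norm_smul]; simp
      _ ≤ _ := by
          refine norm_integral_le_of_norm_le ((μ.integrable_pow_neg_integrablePower).const_mul C) ?_
          filter_upwards with y
          simpa [norm_smul] using hC x y
  | succ j ih =>
    intro V _ _ f
    obtain ⟨C, hC⟩ := ih (fstDeriv f)
    refine ⟨C, fun x => ?_⟩
    rw [← norm_iteratedFDeriv_fderiv]
    convert hC x using 5
    exact (hasFDerivAt_integral_section μ f _).fderiv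

/-- Integrating out the second variable, as an operation on Schwartz functions. -/
def marginal (f : 𝓢(E × F, V)) : 𝓢(E, V) where
  toFun x := ∫ y, f (x, y) ∂μ
  smooth' := contDiff_infty.2 fun n => contDiff_integral_section μ n f
  decay' k j := decay_integral_section μ k j f

theorem marginal_apply (f : 𝓢(E × F, V)) (x : E) : marginal μ f x = ∫ y, f (x, y) ∂μ := rfl

end Marginal

end FreeNilpotent

/-! ### Rotations and derivatives of radial extensions. -/

namespace FreeNilpotent

/-- The vector `(0, 0, t)`. -/
abbrev axis (t : ℝ) : E3 := !₂[0, 0, t]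

theorem norm_axis (t : ℝ) : ‖axis t‖ = |t| := by
  rw [EuclideanSpace.norm_eq]
  simp [Fin.sum_univ_three, Real.sqrt_sq_eq_abs]

theorem smul_axis (s t : ℝ) : s • axis t = axis (s * t) := by
  ext i; fin_cases i <;> simp [axis]

theorem SO3_transpose_mul (k : SO3) : k.1.transpose * k.1 = 1 :=
  (Matrix.mem_orthogonalGroup_iff' _ _).1 (Matrix.mem_specialOrthogonalGroup_iff.1 k.2).1

theorem SO3_mul_transpose (k : SO3) : k.1 * k.1.transpose = 1 :=
  (Matrix.mem_orthogonalGroup_iff _ _).1 (Matrix.mem_specialOrthogonalGroup_iff.1 k.2).1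

theorem norm_rot (k : SO3) (x : E3) : ‖rot k x‖ = ‖x‖ := by
  rw [← sq_eq_sq₀ (norm_nonneg _) (norm_nonneg _), EuclideanSpace.real_norm_sq_eq,
    EuclideanSpace.real_norm_sq_eq]
  have h := fun i j => congrFun (congrFun (SO3_transpose_mul k) i) j
  have h00 := h 0 0
  have h01 := h 0 1
  have h02 := h 0 2
  have h11 := h 1 1
  have h12 := h 1 2
  have h22 := h 2 2
  simp [Matrix.mul_apply, Fin.sum_univ_three] at h00 h01 h02 h11 h12 h22
  simp only [Fin.sum_univ_three, rot_apply]
  linear_combination (x 0) ^ 2 * h00 + (x 1) ^ 2 * h11 + (x 2) ^ 2 * h22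
    + 2 * x 0 * x 1 * h01 + 2 * x 0 * x 2 * h02 + 2 * x 1 * x 2 * h12

/-- A rotation, as a linear isometry. -/
def rotE (k : SO3) : E3 ≃ₗᵢ[ℝ] E3 where
  toFun := rot k
  invFun := rot k⁻¹
  left_inv := rot_inv_rot k
  right_inv := rot_rot_inv k
  map_add' x y := by simp [rot, Matrix.mulVec_add]
  map_smul' c x := by simp [rot, Matrix.mulVec_smul]
  norm_map' := norm_rot k

theorem rotE_apply (k : SO3) (x : E3) : rotE k x = rot k x := rfl

theorem rot_smul (k : SO3) (c : ℝ) (x : E3) : rot k (c • x) = c • rot k x := (rotE k).map_smul c x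

/-- Preserving the plane makes the first two entries of the third row vanish; orthonormality of the
rows then clears the third column. The remaining entry `±1` is the sign by which `k` acts on `t`. -/
theorem mem_K'_apply {k : SO3} (hk : k ∈ K') :
    k.1 2 0 = 0 ∧ k.1 2 1 = 0 ∧ k.1 0 2 = 0 ∧ k.1 1 2 = 0 ∧ k.1 2 2 ^ 2 = 1 := by
  have hk' : rot k '' plane = plane := hk
  have h : ∀ y ∈ plane, rot k y 2 = 0 := fun y hy => by
    have : rot k y ∈ plane := hk' ▸ Set.mem_image_of_mem _ hy
    exact this
  have h0 := h !₂[1, 0, 0] (by simp [plane])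
  have h1 := h !₂[0, 1, 0] (by simp [plane])
  simp [rot_apply] at h0 h1
  have e := fun i j => congrFun (congrFun (SO3_mul_transpose k) i) j
  have e22 := e 2 2
  have e02 := e 0 2
  have e12 := e 1 2
  simp [Matrix.mul_apply, Fin.sum_univ_three, h0, h1] at e22 e02 e12
  have hne : k.1 2 2 ≠ 0 := by intro h; simp [h] at e22
  exact ⟨h0, h1, e02.resolve_right hne, e12.resolve_right hne, by rw [sq]; exact e22⟩

theorem actN'_apply (k : SO3) (x : E3) (t : ℝ) : actN' k (x, t) = (rot k x, k.1 2 2 * t) := by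
  simp [actN', quot, actN, incl, rot_apply]

theorem isK'Invariant_iff {h : N' → ℂ} :
    IsK'Invariant h ↔ ∀ k ∈ K', ∀ x t, h (rot k x, k.1 2 2 * t) = h (x, t) := by
  simp [IsK'Invariant, actN'_apply]

theorem eq_zero_of_rot_axis {k : SO3} {t : ℝ} (h : (0 : E3) = rot k (axis t)) : t = 0 := by
  have := congrArg norm h
  rw [norm_rot, norm_axis, norm_zero] at this
  exact abs_eq_zero.1 this.symm

/-- At `y = 0` the definition of `Radial` picks an arbitrary rotation, so there the formula needs
`h0`. -/
theorem Radial_axis {h : N' → ℂ} (hh : IsK'Invariant h) (h0 : ∀ k x, h (rot k x, 0) = h (x, 0))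
    (x : E3) (k : SO3) (t : ℝ) : Radial h (x, rot k (axis t)) = h (rot k⁻¹ x, t) := by
  by_cases ht : t = 0
  · subst ht
    have H : ∃ kt : SO3 × ℝ, rot k (axis 0) = rot kt.1 !₂[0, 0, kt.2] := ⟨(k, 0), rfl⟩
    unfold Radial
    rw [dif_pos H]
    have hs := H.choose_spec
    generalize H.choose = q at hs
    obtain ⟨l, s⟩ := q
    have e0 : axis 0 = 0 := by ext i; fin_cases i <;> simp
    have e1 : rot k (axis 0) = 0 := by rw [e0]; exact (rotE k).map_zero
    rw [e1] at hs
    have := eq_zero_of_rot_axis hs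
    subst this
    simp only [h0]
  · exact Radial_apply h hh x k t ht

theorem exists_eq_rot_axis {y : E3} (hy : y ≠ 0) :
    ∃ (k : SO3) (t : ℝ), t ≠ 0 ∧ |t| = ‖y‖ ∧ y = rot k (axis t) := by
  obtain ⟨⟨k, t⟩, h⟩ := exists_rot y
  have ht : |t| = ‖y‖ := by rw [h, norm_rot, norm_axis]
  refine ⟨k, t, fun h0 => hy ?_, ht, h⟩
  rw [← norm_eq_zero, ← ht, h0, abs_zero]

/-! ### A smooth local section of `SO(3) → S²` -/

/-- `k` is the half-turn about the bisector `u = z + axis ‖z‖` of `z` and the third axis, that is,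
`x ↦ (2⟨u, x⟩ / ‖u‖²) u - x` with `‖u‖² = 2‖z‖(‖z‖ + z 2)`. It is its own inverse and smooth in `z`
off the closed negative third half-axis. -/
theorem exists_frame {z : E3} (hz : z ≠ 0) (hz' : ‖z‖ + z 2 ≠ 0) :
    ∃ k : SO3, rot k (axis ‖z‖) = z ∧ ∀ x, rot k⁻¹ x =
      (inner ℝ (z + axis ‖z‖) x / (‖z‖ * (‖z‖ + z 2))) • (z + axis ‖z‖) - x := by
  have hr : ‖z‖ ≠ 0 := norm_ne_zero_iff.2 hz
  have hsq : ‖z‖ ^ 2 = z 0 ^ 2 + z 1 ^ 2 + z 2 ^ 2 := by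
    rw [EuclideanSpace.real_norm_sq_eq, Fin.sum_univ_three]
  set k : SO3 := ⟨_, matrix_mem hsq hr hz'⟩ with hk
  have hinv : k⁻¹ = k := by
    refine inv_eq_of_mul_eq_one_left (Subtype.ext ?_)
    have h1 := SO3_mul_transpose k
    have h2 : k.1.transpose = k.1 := by
      ext i j; fin_cases i <;> fin_cases j <;> simp [hk]
    rw [h2] at h1
    exact h1
  refine ⟨k, ?_, fun x => ?_⟩
  · ext i
    rw [rot_apply]
    fin_cases i <;> simp [hk] <;> field_simp
  · rw [hinv]
    ext i
    rw [rot_apply]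
    simp only [PiLp.inner_apply, Fin.sum_univ_three]
    fin_cases i <;> simp [hk] <;> field_simp <;> ring

/-- In the chart given by a local section `z ↦ k_z` of `SO(3) → S²`, the map
`(x, z) ↦ (k_z⁻¹ x, |z|)`. -/
def unroll (p : N) : N' :=
  ((inner ℝ (p.2 + axis ‖p.2‖) p.1 / (‖p.2‖ * (‖p.2‖ + p.2 2))) • (p.2 + axis ‖p.2‖) - p.1, ‖p.2‖)

/-- The domain of `unroll`. -/
def unrollDomain : Set N := {p | p.2 ≠ 0 ∧ ‖p.2‖ + p.2 2 ≠ 0}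

theorem isOpen_unrollDomain : IsOpen unrollDomain := by
  refine IsOpen.inter ?_ ?_
  · exact isOpen_ne_fun continuous_snd continuous_const
  · exact isOpen_ne_fun (by fun_prop) continuous_const

theorem contDiffOn_unroll : ContDiffOn ℝ ∞ unroll unrollDomain := by
  have h2 : ContDiffOn ℝ ∞ (fun p : N => p.2) unrollDomain := contDiff_snd.contDiffOn
  have h1 : ContDiffOn ℝ ∞ (fun p : N => p.1) unrollDomain := contDiff_fst.contDiffOn
  have hn : ContDiffOn ℝ ∞ (fun p : N => ‖p.2‖) unrollDomain := h2.norm ℝ fun p hp => hp.1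
  have hc : ContDiffOn ℝ ∞ (fun p : N => p.2 2) unrollDomain :=
    ((contDiff_piLp_apply (𝕜 := ℝ) (E := fun _ : Fin 3 => ℝ) 2 (i := 2)).comp
      contDiff_snd).contDiffOn
  have ha : ContDiffOn ℝ ∞ (fun p : N => axis ‖p.2‖) unrollDomain := by
    refine (contDiffOn_piLp 2).2 fun i => ?_
    fin_cases i
    · exact contDiffOn_const
    · exact contDiffOn_const
    · exact hn
  have hu := h2.add ha
  refine ContDiffOn.prodMk ?_ hn
  exact (((hu.inner ℝ h1).div (hn.mul (hn.add hc)) fun p hp =>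
    mul_ne_zero (norm_ne_zero_iff.2 hp.1) hp.2).smul hu).sub h1

/-- One chart suffices: undoing `k` and rescaling both variables brings any point with `y ≠ 0` next
to `axis 1`. The free factors `R` and `t` later reduce derivative bounds to a compact set. -/
theorem Radial_eq_unroll {h : N' → ℂ} (hh : IsK'Invariant h) (k : SO3) {t R : ℝ} (ht : t ≠ 0)
    (hR : R ≠ 0) (q : N) (hq : (R⁻¹ • rot k⁻¹ q.1, t⁻¹ • rot k⁻¹ q.2) ∈ unrollDomain) :
    Radial h q = h (R • (unroll (R⁻¹ • rot k⁻¹ q.1, t⁻¹ • rot k⁻¹ q.2)).1,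
      t * (unroll (R⁻¹ • rot k⁻¹ q.1, t⁻¹ • rot k⁻¹ q.2)).2) := by
  obtain ⟨x, y⟩ := q
  obtain ⟨hq1, hq2⟩ := hq
  simp only at hq1 hq2 ⊢
  set z := t⁻¹ • rot k⁻¹ y with hz
  obtain ⟨l, hl1, hl2⟩ := exists_frame hq1 hq2
  have hy : y = rot (k * l) (axis (t * ‖z‖)) := by
    rw [rot_mul, ← smul_axis, rot_smul, hl1, hz, smul_smul, mul_inv_cancel₀ ht, one_smul,
      rot_rot_inv]
  conv_lhs => rw [hy]
  rw [Radial_apply h hh _ _ _ (mul_ne_zero ht (norm_ne_zero_iff.2 hq1))]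
  have e : (unroll (R⁻¹ • rot k⁻¹ x, z)).1 = rot l⁻¹ (R⁻¹ • rot k⁻¹ x) := (hl2 _).symm
  have e2 : (unroll (R⁻¹ • rot k⁻¹ x, z)).2 = ‖z‖ := rfl
  rw [e, e2, rot_smul, smul_smul, mul_inv_cancel₀ hR, one_smul, mul_inv_rev, rot_mul]

/-- The linear map `(x, y) ↦ (R⁻¹ k⁻¹ x, t⁻¹ k⁻¹ y)`. -/
def straighten (k : SO3) (R t : ℝ) : N →L[ℝ] N :=
  (R⁻¹ • (rotE k⁻¹ : E3 →L[ℝ] E3)).prodMap (t⁻¹ • (rotE k⁻¹ : E3 →L[ℝ] E3))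

theorem straighten_apply (k : SO3) (R t : ℝ) (q : N) :
    straighten k R t q = (R⁻¹ • rot k⁻¹ q.1, t⁻¹ • rot k⁻¹ q.2) := rfl

/-- The linear map `(x, s) ↦ (R x, t s)`. -/
def dilate (R t : ℝ) : N' →L[ℝ] N' :=
  (R • ContinuousLinearMap.id ℝ E3).prodMap (t • ContinuousLinearMap.id ℝ ℝ)

theorem dilate_apply (R t : ℝ) (q : N') : dilate R t q = (R • q.1, t * q.2) := rfl

theorem norm_straighten_le (k : SO3) {R t : ℝ} (hR : 1 ≤ R) :
    ‖straighten k R t‖ ≤ 1 + |t|⁻¹ := by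
  refine ContinuousLinearMap.opNorm_le_bound _ (by positivity) fun q => ?_
  rw [straighten_apply, Prod.norm_def]
  simp only [norm_smul, norm_inv, Real.norm_eq_abs, norm_rot]
  refine max_le ?_ ?_
  · have : |R|⁻¹ ≤ 1 := inv_le_one_of_one_le₀ (hR.trans (le_abs_self R))
    exact mul_le_mul (this.trans (by simp)) (norm_fst_le q) (norm_nonneg _) (by positivity)
  · exact mul_le_mul (by simp) (norm_snd_le q) (norm_nonneg _) (by positivity)

theorem norm_dilate_le {R t : ℝ} (hR : 0 ≤ R) : ‖dilate R t‖ ≤ R + |t| := by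
  refine ContinuousLinearMap.opNorm_le_bound _ (by positivity) fun q => ?_
  rw [dilate_apply, Prod.norm_def]
  simp only [norm_smul, norm_mul, Real.norm_eq_abs, abs_of_nonneg hR]
  refine max_le ?_ ?_
  · exact mul_le_mul (by simp) (norm_fst_le q) (norm_nonneg _) (by positivity)
  · exact mul_le_mul (by simp [hR]) (norm_snd_le q) (abs_nonneg _) (by positivity)

theorem axis_mem_unrollDomain (x : E3) : (x, axis 1) ∈ unrollDomain := by
  refine ⟨fun h => ?_, ?_⟩
  · have := norm_axis 1
    simp only at h
    rw [h] at this
    simp at this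
  · simp only [norm_axis]; simp

theorem straighten_axis (k : SO3) {R t : ℝ} (ht : t ≠ 0) (x : E3) :
    straighten k R t (x, rot k (axis t)) = (R⁻¹ • rot k⁻¹ x, axis 1) := by
  rw [straighten_apply]
  simp only [rot_inv_rot, smul_axis, inv_mul_cancel₀ ht]

theorem Radial_eqOn {h : N' → ℂ} (hh : IsK'Invariant h) (k : SO3) {t R : ℝ} (ht : t ≠ 0)
    (hR : R ≠ 0) : Set.EqOn (Radial h) (((h ∘ dilate R t) ∘ unroll) ∘ straighten k R t)
      (straighten k R t ⁻¹' unrollDomain) :=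
  fun q hq => Radial_eq_unroll hh k ht hR q hq

theorem contDiffAt_Radial {h : N' → ℂ} (hs : ContDiff ℝ ∞ h) (hh : IsK'Invariant h) {p : N}
    (hp : p.2 ≠ 0) : ContDiffAt ℝ ∞ (Radial h) p := by
  obtain ⟨x, y⟩ := p
  obtain ⟨k, t, ht, -, hy⟩ := exists_eq_rot_axis hp
  simp only at hy
  have ho : IsOpen (straighten k 1 t ⁻¹' unrollDomain) :=
    isOpen_unrollDomain.preimage (straighten k 1 t).continuous
  have hm : (x, y) ∈ straighten k 1 t ⁻¹' unrollDomain := by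
    rw [Set.mem_preimage, hy, straighten_axis k ht]
    exact axis_mem_unrollDomain _
  have h1 : ContDiffOn ℝ ∞ ((h ∘ dilate 1 t) ∘ unroll) unrollDomain :=
    (hs.comp (dilate 1 t).contDiff).comp_contDiffOn contDiffOn_unroll
  have h2 := h1.comp_continuousLinearMap (straighten k 1 t)
  exact (h2.congr (Radial_eqOn hh k ht one_ne_zero)).contDiffAt (ho.mem_nhds hm)

theorem exists_unroll_bound (j : ℕ) : ∃ D : ℝ, 1 ≤ D ∧ ∀ x : E3, ‖x‖ ≤ 1 → ∀ i, 1 ≤ i → i ≤ j →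
    ‖iteratedFDerivWithin ℝ i unroll unrollDomain (x, axis 1)‖ ≤ D ^ i := by
  have hK : IsCompact (Metric.closedBall (0 : E3) 1 ×ˢ {axis 1}) :=
    (isCompact_closedBall _ _).prod isCompact_singleton
  have hB : ∀ i : ℕ, ∃ B : ℝ, ∀ x : E3, ‖x‖ ≤ 1 →
      ‖iteratedFDerivWithin ℝ i unroll unrollDomain (x, axis 1)‖ ≤ B := by
    intro i
    have hc := contDiffOn_unroll.continuousOn_iteratedFDerivWithin (m := i)
      (by exact_mod_cast le_top) isOpen_unrollDomain.uniqueDiffOn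
    obtain ⟨B, hB⟩ := hK.exists_bound_of_continuousOn (hc.mono (by
      rintro ⟨x, y⟩ ⟨-, hy⟩
      rw [Set.mem_singleton_iff] at hy
      simp only at hy
      rw [hy]
      exact axis_mem_unrollDomain x))
    exact ⟨B, fun x hx => hB _ ⟨by simpa using hx, rfl⟩⟩
  choose B hB using hB
  have hB0 : ∀ i, 0 ≤ B i := fun i => (norm_nonneg _).trans (hB i 0 (by simp))
  -- A base `≥ 1` dominating every `B i` gives `B i ≤ D ≤ D ^ i`, the form required by the bound for
  -- derivatives of a composition.
  have h1 : 1 ≤ 1 + ∑ i ∈ Finset.range (j + 1), B i := by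
    have := Finset.sum_nonneg (s := Finset.range (j + 1)) fun i _ => hB0 i
    linarith
  refine ⟨_, h1, fun x hx i hi hij => ?_⟩
  calc _ ≤ B i := hB i x hx
    _ ≤ ∑ i ∈ Finset.range (j + 1), B i :=
      Finset.single_le_sum (fun i _ => hB0 i) (Finset.mem_range.2 (by omega))
    _ ≤ 1 + ∑ i ∈ Finset.range (j + 1), B i := by linarith
    _ ≤ _ := le_self_pow₀ h1 (by omega)

/-- The derivatives of `Radial h` at `(x, y)`, `y ≠ 0`, are controlled by those of `h` at the points
`(x', t)` with `‖x'‖ = ‖x‖` and `|t| = ‖y‖`. -/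
theorem exists_radial_bound (j : ℕ) : ∃ C : ℝ, 0 ≤ C ∧ ∀ h : N' → ℂ, ContDiff ℝ ∞ h →
    IsK'Invariant h → ∀ (x y : E3), y ≠ 0 → ∀ A : ℝ,
    (∀ i ≤ j, ∀ (x' : E3) (t : ℝ), ‖x'‖ = ‖x‖ → |t| = ‖y‖ → ‖iteratedFDeriv ℝ i h (x', t)‖ ≤ A) →
    ‖iteratedFDeriv ℝ j (Radial h) (x, y)‖ ≤
      C * A * (1 + ‖x‖ + ‖y‖) ^ j * (1 + ‖y‖⁻¹) ^ j := by
  obtain ⟨D, hD1, hD⟩ := exists_unroll_bound j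
  refine ⟨j.factorial * D ^ j, by positivity, fun h hs hh x y hy A hA => ?_⟩
  obtain ⟨k, t, ht, hty, hyk⟩ := exists_eq_rot_axis hy
  have hA0 : 0 ≤ A := (norm_nonneg _).trans (hA 0 (by simp) x t rfl hty)
  -- This `R` moves `x` into the unit ball, where `D` controls `unroll`. The price is `(1 + ‖x‖ +
  -- ‖y‖)^j` from `dilate` and `(1 + ‖y‖⁻¹)^j` from `straighten`.
  set R : ℝ := 1 + ‖x‖ with hRdef
  have hR1 : 1 ≤ R := by simp [hRdef]
  have hR : R ≠ 0 := by positivity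
  set L := straighten k R t with hL
  have ho : IsOpen (L ⁻¹' unrollDomain) := isOpen_unrollDomain.preimage L.continuous
  have hLp : L (x, y) = (R⁻¹ • rot k⁻¹ x, axis 1) := by rw [hyk, hL, straighten_axis k ht]
  have hm : L (x, y) ∈ unrollDomain := by rw [hLp]; exact axis_mem_unrollDomain _
  have h1 : ContDiffOn ℝ ∞ ((h ∘ dilate R t) ∘ unroll) unrollDomain :=
    (hs.comp (dilate R t).contDiff).comp_contDiffOn contDiffOn_unroll
  have e1 : iteratedFDeriv ℝ j (Radial h) (x, y) =
      (iteratedFDerivWithin ℝ j ((h ∘ dilate R t) ∘ unroll) unrollDomain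
        (L (x, y))).compContinuousLinearMap fun _ => L := by
    rw [← iteratedFDerivWithin_of_isOpen j ho hm,
      iteratedFDerivWithin_congr (Radial_eqOn hh k ht hR) hm]
    exact L.iteratedFDerivWithin_comp_right h1 isOpen_unrollDomain.uniqueDiffOn ho.uniqueDiffOn hm
      (by exact_mod_cast le_top)
  have hx1 : ‖R⁻¹ • rot k⁻¹ x‖ ≤ 1 := by
    rw [norm_smul, norm_rot, norm_inv, Real.norm_of_nonneg (by positivity),
      inv_mul_le_one₀ (by positivity)]
    simp [hRdef]
  have hU : dilate R t (unroll (L (x, y))) = (R • (unroll (L (x, y))).1, t) := by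
    have : (unroll (L (x, y))).2 = 1 := by
      rw [hLp]; change ‖axis 1‖ = 1; rw [norm_axis, abs_one]
    rw [dilate_apply, this, mul_one]
  have hUn : ‖R • (unroll (L (x, y))).1‖ = ‖x‖ := by
    obtain ⟨l, -, hl⟩ := exists_frame hm.1 hm.2
    have : (unroll (L (x, y))).1 = rot l⁻¹ (L (x, y)).1 := (hl _).symm
    rw [this, norm_smul, norm_rot, hLp, norm_smul, norm_rot, norm_inv, ← mul_assoc,
      mul_inv_cancel₀ (by positivity), one_mul]
  have e2 : ‖iteratedFDerivWithin ℝ j ((h ∘ dilate R t) ∘ unroll) unrollDomain (L (x, y))‖ ≤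
      j.factorial * (A * (1 + ‖x‖ + ‖y‖) ^ j) * D ^ j := by
    refine norm_iteratedFDerivWithin_comp_le (N := ∞) (t := Set.univ)
      (hs.comp (dilate R t).contDiff).contDiffOn contDiffOn_unroll (by exact_mod_cast le_top)
      uniqueDiffOn_univ isOpen_unrollDomain.uniqueDiffOn (fun _ _ => Set.mem_univ _) hm ?_ ?_
    · intro i hi
      rw [iteratedFDerivWithin_univ, (dilate R t).iteratedFDeriv_comp_right hs _
        (by exact_mod_cast le_top), hU]
      refine (ContinuousMultilinearMap.norm_compContinuousLinearMap_le _ _).trans ?_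
      rw [Finset.prod_const, Finset.card_univ, Fintype.card_fin]
      refine mul_le_mul (hA i hi _ _ hUn hty) ?_ (by positivity) hA0
      calc ‖dilate R t‖ ^ i ≤ (1 + ‖x‖ + ‖y‖) ^ i := by
            gcongr
            rw [← hty]
            exact norm_dilate_le (by positivity)
        _ ≤ _ := pow_le_pow_right₀ (by rw [add_assoc]; simp; positivity) hi
    · intro i hi hij
      rw [hLp]
      exact hD _ hx1 i hi hij
  rw [e1]
  refine (ContinuousMultilinearMap.norm_compContinuousLinearMap_le _ _).trans ?_
  rw [Finset.prod_const, Finset.card_univ, Fintype.card_fin]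
  calc _ ≤ (j.factorial * (A * (1 + ‖x‖ + ‖y‖) ^ j) * D ^ j) * (1 + ‖y‖⁻¹) ^ j := by
        gcongr
        rw [← hty]
        exact norm_straighten_le k hR1
    _ = _ := by ring

end FreeNilpotent

/-! ### Homogeneous polynomials in `y` and Property (R). -/

namespace FreeNilpotent

open Finset

/-- Exponents of the monomials of degree `M` in three variables. -/
abbrev exponents (M : ℕ) : Finset (Fin 3 → ℕ) := piAntidiag (univ : Finset (Fin 3)) M

/-- The monomial `y^α`, with complex values. -/
def monom (α : Fin 3 → ℕ) (y : E3) : ℂ := ∏ i, (y i : ℂ) ^ α i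

theorem contDiff_monom (α : Fin 3 → ℕ) : ContDiff ℝ ∞ (monom α) := by
  refine contDiff_prod fun i _ => ContDiff.pow ?_ _
  exact Complex.ofRealCLM.contDiff.comp (contDiff_piLp_apply (𝕜 := ℝ) (E := fun _ : Fin 3 => ℝ) 2)

theorem coeff_eq_zero_of_forall_ne_zero (s : Finset (Fin 3 → ℕ)) (c : (Fin 3 → ℕ) → ℂ)
    (h : ∀ y : E3, y ≠ 0 → ∑ α ∈ s, c α * monom α y = 0) : ∀ α ∈ s, c α = 0 := by
  classical
  set p : MvPolynomial (Fin 3) ℂ :=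
    ∑ α ∈ s, MvPolynomial.monomial (Finsupp.equivFunOnFinite.symm α) (c α) with hp
  have hp0 : p = 0 := by
    -- Positive coordinates keep `y ≠ 0`, and infinitely many of them force the polynomial to
    -- vanish.
    set S : Set ℂ := (fun r : ℝ => (r : ℂ)) '' Set.Ioi 0
    have hS : S.Infinite :=
      (Set.Ioi_infinite (0 : ℝ)).image (Complex.ofReal_injective.injOn)
    refine MvPolynomial.funext_set (fun _ => S) (fun _ => hS) fun z hz => ?_
    choose y hy hyz using fun i => hz i (Set.mem_univ i)
    have hne : (WithLp.toLp 2 y : E3) ≠ 0 := fun h0 => by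
      have := congrArg (fun v : E3 => v 0) h0
      exact (hy 0).ne' (by simpa using this)
    rw [map_zero, hp, map_sum, ← h _ hne]
    refine sum_congr rfl fun α _ => ?_
    rw [MvPolynomial.eval_monomial, Finsupp.prod_fintype _ _ (by simp)]
    simp only [monom, Finsupp.coe_equivFunOnFinite_symm, ← hyz]
  intro α hα
  have h1 := congrArg (MvPolynomial.coeff (Finsupp.equivFunOnFinite.symm α)) hp0
  rw [hp, MvPolynomial.coeff_sum] at h1
  simpa [MvPolynomial.coeff_monomial, hα] using h1

/-- The coefficients of a polynomial are linear combinations of its values off the origin. -/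
theorem exists_coeff_eq_sum_eval (s : Finset (Fin 3 → ℕ)) {α : Fin 3 → ℕ} (hα : α ∈ s) :
    ∃ l : {y : E3 // y ≠ 0} →₀ ℂ, ∀ c : (Fin 3 → ℕ) → ℂ,
      (l.sum fun y w => w * ∑ β ∈ s, c β * monom β y.1) = c α := by
  classical
  let φ : {y : E3 // y ≠ 0} → Module.Dual ℂ (s → ℂ) := fun y =>
    ∑ β : s, monom β.1 y.1 • LinearMap.proj β
  have hφ : ∀ y v, φ y v = ∑ β : s, v β * monom β.1 y.1 := fun y v => by
    simp [φ, LinearMap.sum_apply, mul_comm]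
  -- The evaluations have trivial common kernel, so by finite-dimensional duality they span the
  -- dual, in particular the coordinate `α`.
  have htop : Submodule.span ℂ (Set.range φ) = ⊤ := by
    have h1 : (Submodule.span ℂ (Set.range φ)).dualCoannihilator = ⊥ := by
      rw [eq_bot_iff]
      intro v hv
      rw [Submodule.mem_dualCoannihilator] at hv
      rw [Submodule.mem_bot]
      have h2 := coeff_eq_zero_of_forall_ne_zero s
        (fun β => if hβ : β ∈ s then v ⟨β, hβ⟩ else 0) (fun y hy => by
          rw [← sum_coe_sort]
          have := hv _ (Submodule.subset_span (Set.mem_range_self ⟨y, hy⟩))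
          rw [hφ] at this
          simpa using this)
      ext β
      simpa using h2 β.1 β.2
    rw [← Subspace.dualCoannihilator_dualAnnihilator_eq (W := Submodule.span ℂ (Set.range φ)), h1,
      Submodule.dualAnnihilator_bot]
  obtain ⟨l, hl⟩ := Finsupp.mem_span_range_iff_exists_finsupp.1
    (htop ▸ Submodule.mem_top : (LinearMap.proj ⟨α, hα⟩ : Module.Dual ℂ (s → ℂ)) ∈ _)
  refine ⟨l, fun c => ?_⟩
  have h3 := congrArg (fun L => L fun β : s => c β.1) hl
  simp only [LinearMap.proj_apply, Finsupp.sum, LinearMap.sum_apply, LinearMap.smul_apply, hφ,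
    smul_eq_mul] at h3
  rw [← h3, Finsupp.sum]
  refine sum_congr rfl fun y _ => ?_
  rw [← sum_coe_sort s]

/-- The coefficient of `t^M` in the Taylor expansion of `g(x, ·)` at `0`. -/
def taylorCoeff (g : N' → ℂ) (M : ℕ) (x : E3) : ℂ :=
  (1 / (M.factorial : ℂ)) * iteratedDeriv M (fun t : ℝ => g (x, t)) 0

theorem taylorTerm_apply (g : N' → ℂ) (M : ℕ) (x : E3) (t : ℝ) :
    taylorTerm g M (x, t) = taylorCoeff g M x * (t : ℂ) ^ M := rfl

theorem isK'Invariant_taylorTerm {g : N' → ℂ} (hg : IsK'Invariant g) (M : ℕ) :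
    IsK'Invariant (taylorTerm g M) := by
  rw [isK'Invariant_iff] at hg ⊢
  intro k hk x t
  have h := hg k hk x
  rw [taylorTerm_apply, taylorTerm_apply]
  rcases mul_self_eq_one_iff.1 ((sq _).symm.trans (mem_K'_apply hk).2.2.2.2) with e | e
  · rw [e] at h ⊢
    simp only [one_mul] at h ⊢
    simp only [taylorCoeff, h]
  · rw [e] at h ⊢
    have h1 : iteratedDeriv M (fun t : ℝ => g (x, t)) 0 =
        (-1) ^ M * iteratedDeriv M (fun t : ℝ => g (rot k x, t)) 0 := by
      have h2 : (fun t : ℝ => g (x, t)) = fun t => g (rot k x, -t) := by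
        ext t; rw [← h t]; simp
      rw [h2, iteratedDeriv_comp_neg M (fun t : ℝ => g (rot k x, t)) 0]
      simp
    simp only [taylorCoeff, h1]
    push_cast
    rw [mul_pow]
    ring

/-- The function `(x, t) ↦ a(x) t^M` extends, through rotations, to a homogeneous polynomial of
degree `M` in `y` with coefficients that are Schwartz functions of `x`. -/
def IsRadialPoly (M : ℕ) (a : E3 → ℂ) : Prop :=
  ∃ c : (Fin 3 → ℕ) → 𝓢(E3, ℂ), ∀ (k : SO3) (x : E3) (t : ℝ),
    a (rot k⁻¹ x) * (t : ℂ) ^ M = ∑ α ∈ exponents M, c α x * monom α (rot k (axis t))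

/-- Rotation of a Schwartz function. -/
def rotS (k : SO3) : 𝓢(E3, ℂ) →L[ℂ] 𝓢(E3, ℂ) :=
  SchwartzMap.compCLMOfContinuousLinearEquiv ℂ (rotE k⁻¹).toContinuousLinearEquiv

theorem rotS_apply (k : SO3) (a : 𝓢(E3, ℂ)) (x : E3) : rotS k a x = a (rot k⁻¹ x) := rfl

theorem continuous_rot_axis (k : SO3) : Continuous fun t : ℝ => rot k (axis t) := by
  refine (rotE k).continuous.comp ((PiLp.continuous_toLp 2 _).comp (continuous_pi fun i => ?_))
  fin_cases i
  · exact continuous_const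
  · exact continuous_const
  · exact continuous_id

/-- Smooth coefficients in (R) are automatically Schwartz: each is a finite combination of values of
the polynomial at points `y ≠ 0`, and each such value is, as a function of `x`, a scalar times a
rotated Taylor coefficient. -/
theorem propertyR_iff {g : N' → ℂ} (hg : IsK'Invariant g)
    (ha : ∀ M, ∃ a : 𝓢(E3, ℂ), ∀ x, a x = taylorCoeff g M x) :
    PropertyR g ↔ ∀ M, IsRadialPoly M (taylorCoeff g M) := by
  classical
  refine forall_congr' fun M => ⟨?_, ?_⟩
  · rintro ⟨P, -, ⟨c, -, hc⟩, hP⟩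
    obtain ⟨a, ha⟩ := ha M
    have hval : ∀ (k : SO3) (x : E3) (t : ℝ), t ≠ 0 →
        ∑ α ∈ exponents M, c α x * monom α (rot k (axis t)) = a (rot k⁻¹ x) * (t : ℂ) ^ M := by
      intro k x t ht
      have hy : rot k (axis t) ≠ 0 := fun h => ht (eq_zero_of_rot_axis h.symm)
      have h1 := hP x _ hy
      rw [hc, Radial_apply _ (isK'Invariant_taylorTerm hg M) _ _ _ ht, taylorTerm_apply, ← ha] at h1
      exact h1
    have hS : ∀ y : {y : E3 // y ≠ 0}, ∃ b : 𝓢(E3, ℂ), ∀ x,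
        b x = ∑ β ∈ exponents M, c β x * monom β y.1 := by
      rintro ⟨y, hy⟩
      obtain ⟨k, t, ht, -, rfl⟩ := exists_eq_rot_axis hy
      refine ⟨(t : ℂ) ^ M • rotS k a, fun x => ?_⟩
      rw [hval k x t ht, smul_apply, rotS_apply, smul_eq_mul, mul_comm]
    choose b hb using hS
    choose l hl using fun α : exponents M => exists_coeff_eq_sum_eval (exponents M) α.2
    set c' : (Fin 3 → ℕ) → 𝓢(E3, ℂ) := fun α =>
      if hα : α ∈ exponents M then ∑ y ∈ (l ⟨α, hα⟩).support, l ⟨α, hα⟩ y • b y else 0 with hc'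
    have hcc : ∀ α ∈ exponents M, ∀ x, c' α x = c α x := by
      intro α hα x
      rw [← hl ⟨α, hα⟩ fun β => c β x, Finsupp.sum, hc']
      simp only [dif_pos hα, _root_.sum_apply, smul_apply, smul_eq_mul, hb]
    refine ⟨c', fun k x t => ?_⟩
    -- (R) says nothing at `y = 0`, so the identity reaches `t = 0` by continuity.
    have hcont : Continuous fun t : ℝ =>
        ∑ α ∈ exponents M, c' α x * monom α (rot k (axis t)) :=
      continuous_finsetSum _ fun α _ => continuous_const.mul
        ((contDiff_monom α).continuous.comp (continuous_rot_axis k))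
    have hcont' : Continuous fun t : ℝ => taylorCoeff g M (rot k⁻¹ x) * (t : ℂ) ^ M := by fun_prop
    refine congrFun (Continuous.ext_on (dense_compl_singleton (0 : ℝ)) hcont' hcont ?_) t
    intro s hs
    simp only
    rw [← ha, ← hval k x s hs]
    exact sum_congr rfl fun α hα => by rw [hcc α hα]
  · rintro ⟨c, hc⟩
    refine ⟨fun p => ∑ α ∈ exponents M, c α p.1 * monom α p.2, ?_, ?_, ?_⟩
    · exact ContDiff.sum fun α _ => (((c α).smooth ⊤).comp contDiff_fst).mul
        ((contDiff_monom α).comp contDiff_snd)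
    · exact ⟨fun α => c α, fun α => (c α).smooth ⊤, fun x y => rfl⟩
    · intro x y hy
      obtain ⟨k, t, ht, -, rfl⟩ := exists_eq_rot_axis hy
      rw [Radial_apply _ (isK'Invariant_taylorTerm hg M) _ _ _ ht, taylorTerm_apply, hc]

end FreeNilpotent

/-! ### Taylor remainders and the Schwartz extension. -/

namespace FreeNilpotent

open Finset

theorem iteratedDeriv_ofReal_pow_zero (j : ℕ) : ∀ M : ℕ,
    iteratedDeriv j (fun t : ℝ => (t : ℂ) ^ M) 0 = if j = M then (M.factorial : ℂ) else 0 := by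
  induction j with
  | zero =>
    intro M
    rcases M with _ | M <;> simp
  | succ j ih =>
    intro M
    rw [iteratedDeriv_succ']
    have hd : deriv (fun t : ℝ => (t : ℂ) ^ M) = fun t : ℝ => (M : ℂ) * (t : ℂ) ^ (M - 1) := by
      ext t
      simpa using ((hasDerivAt_pow M (t : ℂ)).comp_ofReal).deriv
    rw [hd, iteratedDeriv_const_mul_field, ih]
    rcases M with _ | M
    · simp
    · simp [Nat.factorial_succ]

theorem contDiff_section {g : N' → ℂ} (hg : ContDiff ℝ ∞ g) (x : E3) :
    ContDiff ℝ ∞ fun t : ℝ => g (x, t) := hg.comp (contDiff_prodMk_right x)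

/-- The Taylor remainder in the variable `t`. -/
def taylorRem (g : N' → ℂ) (m : ℕ) : N' → ℂ := g + -∑ M ∈ range m, taylorTerm g M

theorem taylorRem_apply (g : N' → ℂ) (m : ℕ) (x : E3) (t : ℝ) :
    taylorRem g m (x, t) = g (x, t) - ∑ M ∈ range m, taylorCoeff g M x * (t : ℂ) ^ M := by
  simp [taylorRem, taylorTerm_apply, sub_eq_add_neg]

theorem sndDeriv_iterate_taylorRem {g : N' → ℂ} (hg : ContDiff ℝ ∞ g) {m : ℕ}
    (hr : ContDiff ℝ ∞ (taylorRem g m)) {j : ℕ} (hj : j < m) (x : E3) :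
    (sndDeriv^[j] (taylorRem g m)) (x, 0) = 0 := by
  have h1 := congrFun (iteratedDeriv_eq_sndDeriv_iterate hr j x) 0
  rw [← h1]
  simp only [taylorRem_apply]
  have hc : ∀ M, ContDiff ℝ ∞ fun t : ℝ => taylorCoeff g M x * (t : ℂ) ^ M := fun M =>
    contDiff_const.mul (Complex.ofRealCLM.contDiff.pow M)
  have hj' : (j : ℕ∞ω) ≤ ∞ := by exact_mod_cast le_top
  rw [iteratedDeriv_fun_sub ((contDiff_section hg x).of_le hj').contDiffAt
    ((ContDiff.sum fun M _ => hc M).of_le hj').contDiffAt,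
    iteratedDeriv_fun_sum fun M _ => ((hc M).of_le hj').contDiffAt]
  simp only [iteratedDeriv_const_mul_field, iteratedDeriv_ofReal_pow_zero]
  rw [sum_eq_single j (fun M _ hM => by simp [hM.symm]) (fun h => absurd (mem_range.2 hj) h)]
  have : (j.factorial : ℂ) ≠ 0 := by exact_mod_cast j.factorial_ne_zero
  simp only [taylorCoeff, if_true]
  field_simp
  simp

/-- `Radial` evaluates all functions at the same chosen `(k, t)`, so it is linear even where that
choice matters. -/
theorem Radial_taylorRem (g : N' → ℂ) (m : ℕ) (p : N) :
    Radial (taylorRem g m) p = Radial g p - ∑ M ∈ range m, Radial (taylorTerm g M) p := by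
  obtain ⟨kt, h⟩ := exists_rot p.2
  have H : ∃ kt : SO3 × ℝ, p.2 = rot kt.1 !₂[0, 0, kt.2] := ⟨kt, h⟩
  simp only [Radial, dif_pos H, taylorRem_apply, taylorTerm_apply]

theorem isK'Invariant_taylorRem {g : N' → ℂ} (hg : IsK'Invariant g) (m : ℕ) :
    IsK'Invariant (taylorRem g m) := by
  intro k hk p
  simp only [taylorRem, Pi.add_apply, Pi.neg_apply, Finset.sum_apply]
  rw [hg k hk p]
  congr 2
  exact sum_congr rfl fun M _ => isK'Invariant_taylorTerm hg M k hk p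

section

variable {g : N' → ℂ}

/-- The polynomial in `y` with coefficients `c`. -/
def radialPoly (c : (Fin 3 → ℕ) → 𝓢(E3, ℂ)) (M : ℕ) : N → ℂ :=
  ∑ α ∈ exponents M, fun p => c α p.1 * monom α p.2

theorem radialPoly_apply (c : (Fin 3 → ℕ) → 𝓢(E3, ℂ)) (M : ℕ) (p : N) :
    radialPoly c M p = ∑ α ∈ exponents M, c α p.1 * monom α p.2 := by
  simp [radialPoly]

theorem xDecay_radialPoly (c : (Fin 3 → ℕ) → 𝓢(E3, ℂ)) (M : ℕ) : XDecay (radialPoly c M) :=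
  XDecay.sum fun α _ => XDecay.tensor (c α) (contDiff_monom α)

theorem contDiff_axis : ContDiff ℝ ∞ axis := by
  refine (contDiff_piLp 2).2 fun i => ?_
  fin_cases i
  · exact contDiff_const
  · exact contDiff_const
  · exact contDiff_id

/-- At `t = 0` the right side of `hc` does not see `k`, since every rotation fixes the origin. -/
theorem inv_zero_of_radialPoly {M : ℕ} {c : (Fin 3 → ℕ) → 𝓢(E3, ℂ)}
    (hc : ∀ (k : SO3) (x : E3) (t : ℝ), taylorTerm g M (rot k⁻¹ x, t) =
      radialPoly c M (x, rot k (axis t))) (k : SO3) (x : E3) :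
    taylorTerm g M (rot k x, 0) = taylorTerm g M (x, 0) := by
  have h0 : axis 0 = 0 := by ext i; fin_cases i <;> simp
  have h1 : ∀ l : SO3, rot l (axis 0) = 0 := fun l => by rw [h0]; exact (rotE l).map_zero
  have h2 := hc k⁻¹ x 0
  have h3 := hc 1 x 0
  rw [h1] at h2 h3
  rw [inv_inv] at h2
  rw [inv_one, rot_one] at h3
  rw [h2, h3]

theorem taylorTerm_zero_apply (g : N' → ℂ) (x : E3) : taylorTerm g 0 (x, 0) = g (x, 0) := by
  simp [taylorTerm_apply, taylorCoeff]

theorem xDecay_taylorTerm {M : ℕ} {c : (Fin 3 → ℕ) → 𝓢(E3, ℂ)}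
    (hc : ∀ (k : SO3) (x : E3) (t : ℝ), taylorTerm g M (rot k⁻¹ x, t) =
      radialPoly c M (x, rot k (axis t))) : XDecay (taylorTerm g M) := by
  have h1 : taylorTerm g M = ∑ α ∈ exponents M, fun p : N' => c α p.1 * monom α (axis p.2) := by
    ext ⟨x, t⟩
    have h3 := hc 1 x t
    rw [inv_one, rot_one, rot_one, radialPoly_apply] at h3
    simpa using h3
  rw [h1]
  exact XDecay.sum fun α _ => XDecay.tensor (c α) ((contDiff_monom α).comp contDiff_axis)

theorem Radial_taylorTerm (hg : IsK'Invariant g) {M : ℕ} {c : (Fin 3 → ℕ) → 𝓢(E3, ℂ)}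
    (hc : ∀ (k : SO3) (x : E3) (t : ℝ), taylorTerm g M (rot k⁻¹ x, t) =
      radialPoly c M (x, rot k (axis t))) : Radial (taylorTerm g M) = radialPoly c M := by
  ext ⟨x, y⟩
  obtain ⟨⟨k, t⟩, rfl⟩ := exists_rot y
  rw [← hc]
  exact Radial_axis (isK'Invariant_taylorTerm hg M) (inv_zero_of_radialPoly hc) x k t

theorem pow_mul_two_add_pow_le {r : ℝ} (hr : 0 ≤ r) (k j : ℕ) :
    r ^ k * (2 + r) ^ j ≤ 3 ^ j * (1 + r ^ (k + j)) := by
  rcases le_total r 1 with h | h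
  · calc r ^ k * (2 + r) ^ j ≤ 1 * 3 ^ j := by
          gcongr
          · exact pow_le_one₀ hr h
          · linarith
      _ ≤ 3 ^ j * (1 + r ^ (k + j)) := by
          rw [one_mul]; exact le_mul_of_one_le_right (by positivity) (by simp; positivity)
  · calc r ^ k * (2 + r) ^ j ≤ r ^ k * (3 * r) ^ j := by gcongr; linarith
      _ = 3 ^ j * r ^ (k + j) := by rw [mul_pow, pow_add]; ring
      _ ≤ 3 ^ j * (1 + r ^ (k + j)) := by gcongr; simp

/-- Near `{y = 0}`, radial extensions of functions vanishing to high order at `t = 0` are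
small, together with their derivatives. -/
theorem radial_flat_estimate {f : N' → ℂ} (hf : XDecay f) (hi : IsK'Invariant f) {m : ℕ}
    (h0 : ∀ i < m, ∀ x, iteratedFDeriv ℝ i f (x, 0) = 0) (k j : ℕ) (hj : 2 * j + 2 ≤ m) :
    ∃ C : ℝ, ∀ (x y : E3), y ≠ 0 → ‖y‖ ≤ 1 →
      ‖x‖ ^ k * ‖iteratedFDeriv ℝ j (Radial f) (x, y)‖ ≤ C * ‖y‖ ^ 2 := by
  obtain ⟨C, hC0, hC⟩ := exists_radial_bound j
  obtain ⟨B₀, hB₀⟩ := hf.decay 0 m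
  -- The weights `0` and `k + j` together give the divisor `1 + ‖x‖^(k + j)`, which absorbs both
  -- `‖x‖^k` and the growth factor `(1 + ‖x‖ + ‖y‖)^j`.
  obtain ⟨B₁, hB₁⟩ := hf.decay (k + j) m
  have hB : 0 ≤ B₀ + B₁ :=
    add_nonneg ((by positivity : (0:ℝ) ≤ _).trans (hB₀ 0 0 (by simp)))
      ((by positivity : (0:ℝ) ≤ _).trans (hB₁ 0 0 (by simp)))
  refine ⟨C * (B₀ + B₁) * 3 ^ j * 2 ^ j, fun x y hy hy1 => ?_⟩
  have hny : 0 < ‖y‖ := norm_pos_iff.2 hy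
  have hpos : 0 < 1 + ‖x‖ ^ (k + j) := by positivity
  have hA : ∀ i ≤ j, ∀ (x' : E3) (t : ℝ), ‖x'‖ = ‖x‖ → |t| = ‖y‖ →
      ‖iteratedFDeriv ℝ i f (x', t)‖ ≤ (B₀ + B₁) / (1 + ‖x‖ ^ (k + j)) * ‖y‖ ^ (m - j) := by
    intro i hij x' t hx' ht
    have hm : ∀ s : ℝ, |s| ≤ 1 → ‖iteratedFDeriv ℝ m f (x', s)‖ ≤
        (B₀ + B₁) / (1 + ‖x‖ ^ (k + j)) := by
      intro s hs
      rw [le_div_iff₀ hpos, ← hx']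
      have e0 := hB₀ x' s hs
      have e1 := hB₁ x' s hs
      rw [pow_zero, one_mul] at e0
      linarith
    refine (norm_iteratedFDeriv_le_of_flat hf.contDiff h0 hm (by omega) (ht.trans_le hy1)).trans ?_
    rw [ht]
    exact mul_le_mul_of_nonneg_left (pow_le_pow_of_le_one hny.le hy1 (by omega))
      (div_nonneg hB hpos.le)
  have h1 := hC f hf.contDiff hi x y hy _ hA
  -- Flatness leaves `‖y‖^(m - j)` and the radial extension costs `‖y‖^(-j)`; `2 * j + 2 ≤ m` leaves
  -- the required square.
  have h2 : ‖y‖ ^ (m - j) * (1 + ‖y‖⁻¹) ^ j ≤ 2 ^ j * ‖y‖ ^ 2 := by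
    have h3 : 1 + ‖y‖⁻¹ ≤ 2 * ‖y‖⁻¹ := by
      have := (one_le_inv₀ hny).2 hy1
      linarith
    obtain ⟨d, hd⟩ : ∃ d, m - j = j + (d + 2) := ⟨m - j - j - 2, by omega⟩
    calc ‖y‖ ^ (m - j) * (1 + ‖y‖⁻¹) ^ j ≤ ‖y‖ ^ (m - j) * (2 * ‖y‖⁻¹) ^ j := by gcongr
      _ = 2 ^ j * ‖y‖ ^ (d + 2) := by
        rw [hd, mul_pow, pow_add _ j, inv_pow]
        field_simp
      _ ≤ 2 ^ j * ‖y‖ ^ 2 := by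
        gcongr 2 ^ j * ?_
        exact pow_le_pow_of_le_one hny.le hy1 (by omega)
  have h4 : ‖x‖ ^ k * (1 + ‖x‖ + ‖y‖) ^ j ≤ 3 ^ j * (1 + ‖x‖ ^ (k + j)) := by
    refine le_trans ?_ (pow_mul_two_add_pow_le (norm_nonneg x) k j)
    have : 1 + ‖x‖ + ‖y‖ ≤ 2 + ‖x‖ := by linarith
    gcongr
  have hCB : 0 ≤ C * ((B₀ + B₁) / (1 + ‖x‖ ^ (k + j))) :=
    mul_nonneg hC0 (div_nonneg hB hpos.le)
  calc _ ≤ ‖x‖ ^ k * _ := mul_le_mul_of_nonneg_left h1 (by positivity)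
    _ = C * ((B₀ + B₁) / (1 + ‖x‖ ^ (k + j))) * ((‖x‖ ^ k * (1 + ‖x‖ + ‖y‖) ^ j) *
        (‖y‖ ^ (m - j) * (1 + ‖y‖⁻¹) ^ j)) := by ring
    _ ≤ C * ((B₀ + B₁) / (1 + ‖x‖ ^ (k + j))) * ((3 ^ j * (1 + ‖x‖ ^ (k + j))) *
        (2 ^ j * ‖y‖ ^ 2)) := by
        refine mul_le_mul_of_nonneg_left ?_ hCB
        exact mul_le_mul h4 h2 (by positivity) (by positivity)
    _ = _ := by field_simp

/-- Away from `{y = 0}`, the radial extension of a Schwartz function decays rapidly. -/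
theorem radial_far_estimate (g : 𝓢(N', ℂ)) (hi : IsK'Invariant g) (k j : ℕ) :
    ∃ C : ℝ, ∀ p : N, 1 ≤ ‖p.2‖ → ‖p‖ ^ k * ‖iteratedFDeriv ℝ j (Radial g) p‖ ≤ C := by
  obtain ⟨C, hC0, hC⟩ := exists_radial_bound j
  set S : ℝ := 2 ^ (k + j) *
    ((Finset.Iic (k + j, j)).sup fun m => SchwartzMap.seminorm ℝ m.1 m.2) g with hS
  have hS0 : 0 ≤ S := mul_nonneg (by positivity) (apply_nonneg _ _)
  refine ⟨C * S * 2 ^ j * 2 ^ j, fun ⟨x, y⟩ hy1 => ?_⟩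
  simp only at hy1
  have hny : 0 < ‖y‖ := by linarith
  set q := 1 + ‖(x, y)‖ with hq
  have hq0 : 0 < q := by positivity
  have hA : ∀ i ≤ j, ∀ (x' : E3) (t : ℝ), ‖x'‖ = ‖x‖ → |t| = ‖y‖ →
      ‖iteratedFDeriv ℝ i g (x', t)‖ ≤ S / q ^ (k + j) := by
    intro i hij x' t hx' ht
    rw [le_div_iff₀ (by positivity), mul_comm]
    have h1 := SchwartzMap.one_add_le_sup_seminorm_apply (𝕜 := ℝ) (m := (k + j, j))
      (k := k + j) (n := i) le_rfl hij g (x', t)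
    have e : ‖(x', t)‖ = ‖(x, y)‖ := by
      rw [Prod.norm_def, Prod.norm_def]; simp only [hx', Real.norm_eq_abs, ht]
    rwa [e] at h1
  have h1 := hC g (g.smooth ⊤) hi x y (norm_pos_iff.1 hny) _ hA
  have h2 : ‖x‖ ≤ ‖(x, y)‖ := norm_fst_le (x, y)
  have h3 : ‖y‖ ≤ ‖(x, y)‖ := norm_snd_le (x, y)
  have h4 : ‖y‖⁻¹ ≤ 1 := inv_le_one_of_one_le₀ hy1
  calc _ ≤ q ^ k * (C * (S / q ^ (k + j)) * (2 * q) ^ j * 2 ^ j) := by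
        refine mul_le_mul (by gcongr; simp [hq]) (h1.trans ?_) (norm_nonneg _) (by positivity)
        have : 0 ≤ C * (S / q ^ (k + j)) := by positivity
        gcongr
        · linarith
        · linarith
    _ = _ := by
        rw [mul_pow, pow_add]
        field_simp

end

/-- A `K'`-invariant Schwartz function on `N'` whose Taylor coefficients at `t = 0` are radially
polynomial extends to a `K`-invariant Schwartz function on `N`. -/
theorem exists_schwartz_extension (g : 𝓢(N', ℂ)) (hg : IsK'Invariant g)
    (hR : ∀ M, IsRadialPoly M (taylorCoeff g M)) :
    ∃ H : 𝓢(N, ℂ), IsKInvariant H ∧ ∀ x t, H (x, axis t) = g (x, t) := by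
  choose c hc' using hR
  have hc : ∀ (M : ℕ) (k : SO3) (x : E3) (t : ℝ), taylorTerm g M (rot k⁻¹ x, t) =
      radialPoly (c M) M (x, rot k (axis t)) := fun M k x t => by
    rw [taylorTerm_apply, hc', radialPoly_apply]
  -- Degree `0` of the hypothesis makes `Radial g` well defined on `{y = 0}`.
  have hg0 : ∀ k x, g (rot k x, 0) = g (x, 0) := fun k x => by
    have := inv_zero_of_radialPoly (hc 0) k x
    rwa [taylorTerm_zero_apply, taylorTerm_zero_apply] at this
  have hRad := Radial_axis hg hg0
  have hgs : ContDiff ℝ ∞ g := g.smooth ⊤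
  set S : ℕ → N → ℂ := fun m => ∑ M ∈ range m, radialPoly (c M) M with hS
  have hSd : ∀ m, XDecay (S m) := fun m => XDecay.sum fun M _ => xDecay_radialPoly (c M) M
  have hr : ∀ m, XDecay (taylorRem g m) := fun m =>
    (xDecay_schwartz g).add (XDecay.sum fun M _ => xDecay_taylorTerm (hc M)).neg
  have hri := isK'Invariant_taylorRem hg
  have hr0 : ∀ m, ∀ i < m, ∀ x, iteratedFDeriv ℝ i (taylorRem g m) (x, 0) = 0 := fun m i him =>
    iteratedFDeriv_eq_zero_of_sndDeriv i (hr m).contDiff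
      (fun j hj x => sndDeriv_iterate_taylorRem hgs (hr m).contDiff hj x) him
  have hdec : ∀ m, Radial g = Radial (taylorRem g m) + S m := fun m => by
    ext p
    simp [Radial_taylorRem, hS, Radial_taylorTerm hg (hc _)]
  have hz : ∀ m, 0 < m → ∀ p : N, p.2 = 0 → Radial (taylorRem g m) p = 0 := by
    rintro m hm ⟨x, y⟩ hp
    simp only at hp
    subst hp
    have h0 : ∀ x, taylorRem g m (x, 0) = 0 := fun x => by
      have := congrArg norm (hr0 m 0 hm x)
      rwa [norm_iteratedFDeriv_zero, norm_zero, norm_eq_zero] at this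
    have e : (0 : E3) = rot 1 (axis 0) := by
      rw [rot_one]; ext i; fin_cases i <;> simp
    rw [e, Radial_axis (hri m) (fun k x => by rw [h0, h0]), h0]
  have hsm : ∀ p : N, p.2 ≠ 0 → ∀ m, ContDiffAt ℝ ∞ (Radial (taylorRem g m)) p :=
    fun p hp m => contDiffAt_Radial (hr m).contDiff (hri m) hp
  have hCD : ContDiff ℝ ∞ (Radial g) := by
    refine contDiff_infty.2 fun n => ?_
    -- The splitting may depend on `n`, since its sum is always the same function.
    rw [hdec (2 * n + 2)]
    refine ContDiff.add ?_ ((hSd _).contDiff.of_le (by exact_mod_cast le_top))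
    refine contDiff_of_flat n (hz _ (by omega)) (fun p hp => hsm p hp _) fun j hj => ?_
    obtain ⟨C, hC⟩ := radial_flat_estimate (hr (2 * n + 2)) (hri _) (hr0 _) 0 j (by omega)
    exact ⟨C, fun p hp hp1 => by simpa using hC p.1 p.2 hp hp1⟩
  have hdecay : ∀ k j : ℕ, ∃ C : ℝ, ∀ p : N, ‖p‖ ^ k * ‖iteratedFDeriv ℝ j (Radial g) p‖ ≤ C := by
    intro k j
    obtain ⟨C₁, hC₁⟩ := radial_far_estimate g hg k j
    have hnear : ∀ k, ∃ C : ℝ, ∀ p : N, p.2 ≠ 0 → ‖p.2‖ ≤ 1 →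
        ‖p.1‖ ^ k * ‖iteratedFDeriv ℝ j (Radial g) p‖ ≤ C := by
      intro k
      obtain ⟨C, hC⟩ := radial_flat_estimate (hr (2 * j + 2)) (hri _) (hr0 _) k j le_rfl
      obtain ⟨D, hD⟩ := (hSd (2 * j + 2)).decay k j
      refine ⟨|C| + D, fun p hp hp1 => ?_⟩
      have hj' : (j : ℕ∞ω) ≤ ∞ := by exact_mod_cast le_top
      rw [hdec (2 * j + 2), iteratedFDeriv_add_apply ((hsm p hp _).of_le hj')
        ((hSd _).contDiff.of_le hj').contDiffAt]
      have h1 := hC p.1 p.2 hp hp1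
      have h2 := hD p.1 p.2 hp1
      have h3 : C * ‖p.2‖ ^ 2 ≤ |C| := by
        calc C * ‖p.2‖ ^ 2 ≤ |C| * 1 := mul_le_mul (le_abs_self C)
              (pow_le_one₀ (norm_nonneg _) hp1) (by positivity) (abs_nonneg _)
          _ = |C| := mul_one _
      calc _ ≤ ‖p.1‖ ^ k * (‖iteratedFDeriv ℝ j (Radial (taylorRem g (2 * j + 2))) p‖ +
            ‖iteratedFDeriv ℝ j (S (2 * j + 2)) p‖) := by gcongr; exact norm_add_le _ _
        _ ≤ |C| + D := by rw [mul_add]; exact add_le_add (h1.trans h3) h2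
    obtain ⟨C₂, hC₂⟩ := hnear k
    -- The exponent `0` covers the points where `‖p‖` is `‖p.2‖ ≤ 1` rather than `‖p.1‖`.
    obtain ⟨C₃, hC₃⟩ := hnear 0
    refine ⟨max C₁ (C₂ + C₃), ?_⟩
    -- Both estimates concern `y ≠ 0`; continuity of the derivatives, known from `hCD`, carries them
    -- to `y = 0`.
    have hdense : Dense {p : N | p.2 ≠ 0} :=
      (dense_compl_singleton (0 : E3)).preimage isOpenMap_snd
    have hclosed : IsClosed {p : N | ‖p‖ ^ k * ‖iteratedFDeriv ℝ j (Radial g) p‖ ≤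
        max C₁ (C₂ + C₃)} :=
      isClosed_le ((continuous_norm.pow k).mul
        (hCD.continuous_iteratedFDeriv (by exact_mod_cast le_top)).norm) continuous_const
    have hsub : {p : N | p.2 ≠ 0} ⊆ {p : N | ‖p‖ ^ k * ‖iteratedFDeriv ℝ j (Radial g) p‖ ≤
        max C₁ (C₂ + C₃)} := by
      intro p hp
      rcases le_total (1 : ℝ) ‖p.2‖ with h | h
      · exact (hC₁ p h).trans (le_max_left _ _)
      · refine le_trans ?_ (le_max_right C₁ (C₂ + C₃))
        have h2 := hC₂ p hp h
        have h3 := hC₃ p hp h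
        have h4 : ‖p‖ ^ k ≤ ‖p.1‖ ^ k + ‖p.1‖ ^ 0 := by
          rcases max_choice ‖p.1‖ ‖p.2‖ with e | e
          · rw [Prod.norm_def, e]; simp
          · rw [Prod.norm_def, e, pow_zero]
            have := pow_le_one₀ (n := k) (norm_nonneg p.2) h
            have h5 : 0 ≤ ‖p.1‖ ^ k := by positivity
            linarith
        calc _ ≤ (‖p.1‖ ^ k + ‖p.1‖ ^ 0) * ‖iteratedFDeriv ℝ j (Radial g) p‖ := by gcongr
          _ ≤ _ := by rw [add_mul]; exact add_le_add h2 h3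
    intro p
    exact (hclosed.closure_subset_iff.2 hsub) (hdense p)
  refine ⟨⟨Radial g, hCD, hdecay⟩, ?_, fun x t => ?_⟩
  · rintro k ⟨x, y⟩
    obtain ⟨⟨l, t⟩, rfl⟩ := exists_rot y
    change Radial g (rot k x, rot k (rot l (axis t))) = Radial g (x, rot l (axis t))
    rw [← rot_mul, hRad, hRad, mul_inv_rev, rot_mul, rot_inv_rot]
  · have := hRad x 1 t
    rw [inv_one, rot_one, rot_one] at this
    exact this

end FreeNilpotent

/-! ### Fourier transforms, fibre integrals and moments. -/

namespace FreeNilpotent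

open MeasureTheory FourierTransform

/-! ### Fourier transforms normalised by `exp (-i ⟨x, ξ⟩)` -/

section FourierNormalisation

variable (V : Type) [NormedAddCommGroup V] [InnerProductSpace ℝ V] [FiniteDimensional ℝ V]

/-- Multiplication by `c ≠ 0`. -/
def scaleE (c : ℝ) (hc : c ≠ 0) : V ≃L[ℝ] V :=
  (LinearEquiv.smulOfNeZero ℝ V c hc).toContinuousLinearEquiv

theorem two_pi_inv_ne_zero : (2 * Real.pi)⁻¹ ≠ 0 := inv_ne_zero Real.two_pi_pos.ne'

variable [MeasurableSpace V] [BorelSpace V]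

/-- The Fourier transform `f ↦ ∫ f(x) exp (-i ⟨x, ξ⟩) dx`. -/
def angFT : 𝓢(V, ℂ) →L[ℂ] 𝓢(V, ℂ) :=
  (SchwartzMap.compCLMOfContinuousLinearEquiv ℂ
    (scaleE V (2 * Real.pi)⁻¹ two_pi_inv_ne_zero)).comp (fourierCLM ℂ 𝓢(V, ℂ))

variable {V}

theorem fourier_scale (f : V → ℂ) (ξ : V) :
    𝓕 f ((2 * Real.pi)⁻¹ • ξ) = ∫ x, f x * Complex.exp (-(Complex.I * ((inner ℝ x ξ : ℝ) : ℂ))) := by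
  rw [Real.fourier_eq']
  congr 1
  ext x
  rw [smul_eq_mul, mul_comm, inner_smul_right]
  congr 2
  push_cast
  have : (Real.pi : ℂ) ≠ 0 := by exact_mod_cast Real.pi_ne_zero
  field_simp

theorem angFT_apply (f : 𝓢(V, ℂ)) (ξ : V) :
    angFT V f ξ = ∫ x, f x * Complex.exp (-(Complex.I * ((inner ℝ x ξ : ℝ) : ℂ))) :=
  fourier_scale f ξ

theorem compCLMOfContinuousLinearEquiv_bijective {D E : Type*} [NormedAddCommGroup D]
    [NormedSpace ℝ D] [NormedAddCommGroup E] [NormedSpace ℝ E] (e : D ≃L[ℝ] E) :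
    Function.Bijective (SchwartzMap.compCLMOfContinuousLinearEquiv ℂ e (F := ℂ)) := by
  refine Function.bijective_iff_has_inverse.2
    ⟨SchwartzMap.compCLMOfContinuousLinearEquiv ℂ e.symm, fun f => ?_, fun f => ?_⟩ <;>
  · ext x; simp

theorem angFT_bijective : Function.Bijective (angFT V) := by
  refine (compCLMOfContinuousLinearEquiv_bijective _).comp ?_
  exact (fourierCLE ℂ 𝓢(V, ℂ)).bijective

theorem angFT_comp_isometry (f : 𝓢(V, ℂ)) (R : V ≃ₗᵢ[ℝ] V) (ξ : V) :
    angFT V (SchwartzMap.compCLMOfContinuousLinearEquiv ℂ R.toContinuousLinearEquiv f) ξ =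
      angFT V f (R ξ) := by
  rw [angFT_apply, angFT_apply]
  conv_rhs => rw [← R.measurePreserving.integral_comp R.toHomeomorph.measurableEmbedding]
  simp only [R.inner_map_map]
  rfl

variable (E F : Type) [NormedAddCommGroup E] [InnerProductSpace ℝ E] [FiniteDimensional ℝ E]
  [MeasurableSpace E] [BorelSpace E] [NormedAddCommGroup F] [InnerProductSpace ℝ F]
  [FiniteDimensional ℝ F] [MeasurableSpace F] [BorelSpace F]

/-- The Fourier transform on a product. -/
def prodFT : 𝓢(E × F, ℂ) →L[ℂ] 𝓢(E × F, ℂ) :=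
  (SchwartzMap.compCLMOfContinuousLinearEquiv ℂ (WithLp.prodContinuousLinearEquiv 2 ℝ E F).symm).comp
    ((angFT (WithLp 2 (E × F))).comp
      (SchwartzMap.compCLMOfContinuousLinearEquiv ℂ (WithLp.prodContinuousLinearEquiv 2 ℝ E F)))

variable {E F}

theorem prodFT_bijective : Function.Bijective (prodFT E F) :=
  (compCLMOfContinuousLinearEquiv_bijective _).comp
    (angFT_bijective.comp (compCLMOfContinuousLinearEquiv_bijective _))

theorem prodFT_apply (f : 𝓢(E × F, ℂ)) (ξ : E) (η : F) :
    prodFT E F f (ξ, η) = ∫ p : E × F, f p *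
      Complex.exp (-(Complex.I * ((inner ℝ p.1 ξ + inner ℝ p.2 η : ℝ) : ℂ))) := by
  have h1 : prodFT E F f (ξ, η) = angFT (WithLp 2 (E × F))
      (SchwartzMap.compCLMOfContinuousLinearEquiv ℂ (WithLp.prodContinuousLinearEquiv 2 ℝ E F) f)
      (WithLp.toLp 2 (ξ, η)) := rfl
  rw [h1, angFT_apply, ← (WithLp.volume_preserving_ofLp E F).integral_comp
    (WithLp.prodContinuousLinearEquiv 2 ℝ E F).toHomeomorph.measurableEmbedding]
  rfl

/-- The product of two linear isometries. -/
def prodE (R : E ≃ₗᵢ[ℝ] E) (S : F ≃ₗᵢ[ℝ] F) : (E × F) ≃L[ℝ] (E × F) :=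
  R.toContinuousLinearEquiv.prodCongr S.toContinuousLinearEquiv

theorem prodFT_comp_isometry (f : 𝓢(E × F, ℂ)) (R : E ≃ₗᵢ[ℝ] E) (S : F ≃ₗᵢ[ℝ] F) (ξ : E) (η : F) :
    prodFT E F (SchwartzMap.compCLMOfContinuousLinearEquiv ℂ (prodE R S) f) (ξ, η) =
      prodFT E F f (R ξ, S η) := by
  have hmp : MeasurePreserving (prodE R S) := R.measurePreserving.prod S.measurePreserving
  rw [prodFT_apply, prodFT_apply]
  conv_rhs => rw [← hmp.integral_comp (prodE R S).toHomeomorph.measurableEmbedding]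
  have e1 : ∀ p : E × F, (prodE R S p).1 = R p.1 := fun _ => rfl
  have e2 : ∀ p : E × F, (prodE R S p).2 = S p.2 := fun _ => rfl
  simp only [e1, e2, R.inner_map_map, S.inner_map_map]
  rfl

/-- Invariance is a fixed-point equation for composition with an isometry, which commutes with the
injective map `prodFT`. -/
theorem invariant_prodFT_iff (f : 𝓢(E × F, ℂ)) (R : E ≃ₗᵢ[ℝ] E) (S : F ≃ₗᵢ[ℝ] F) :
    (∀ p, prodFT E F f (R p.1, S p.2) = prodFT E F f p) ↔ ∀ p, f (R p.1, S p.2) = f p := by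
  have h1 : (∀ p, f (R p.1, S p.2) = f p) ↔
      SchwartzMap.compCLMOfContinuousLinearEquiv ℂ (prodE R S) f = f :=
    ⟨fun h => SchwartzMap.ext h, fun h p => DFunLike.congr_fun h p⟩
  rw [h1, ← prodFT_bijective.injective.eq_iff]
  exact ⟨fun h => SchwartzMap.ext fun ⟨ξ, η⟩ => by rw [prodFT_comp_isometry]; exact h (ξ, η),
    fun h ⟨ξ, η⟩ => by rw [← prodFT_comp_isometry, h]⟩

end FourierNormalisation

theorem isKInvariant_prodFT_iff (F : 𝓢(N, ℂ)) :
    IsKInvariant (prodFT E3 E3 F) ↔ IsKInvariant F :=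
  forall_congr' fun k => invariant_prodFT_iff F (rotE k) (rotE k)

theorem fourierXT_eq (G : 𝓢(N', ℂ)) : fourierXT G = prodFT E3 ℝ G := by
  ext ⟨ξ, s⟩
  rw [prodFT_apply, fourierXT]
  congr 1
  ext p
  rw [mul_assoc, ← Complex.exp_add]
  congr 2
  simp [mul_comm]
  ring

/-- Multiplication by `±1` on `ℝ` is a linear isometry. -/
theorem exists_isometry_of_sq_eq_one {c : ℝ} (hc : c ^ 2 = 1) :
    ∃ S : ℝ ≃ₗᵢ[ℝ] ℝ, ∀ t, S t = c * t := by
  rcases mul_self_eq_one_iff.1 ((sq _).symm.trans hc) with rfl | rfl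
  · exact ⟨LinearIsometryEquiv.refl ℝ ℝ, fun t => by simp⟩
  · exact ⟨LinearIsometryEquiv.neg ℝ, fun t => by simp⟩

theorem isK'Invariant_fourierXT (G : 𝓢(N', ℂ)) (hG : IsK'Invariant G) :
    IsK'Invariant (fourierXT G) := by
  rw [fourierXT_eq]
  rw [isK'Invariant_iff] at hG ⊢
  intro k hk x t
  obtain ⟨S, hS⟩ := exists_isometry_of_sq_eq_one (mem_K'_apply hk).2.2.2.2
  have h := (invariant_prodFT_iff G (rotE k) S).2 fun p => by
    rw [rotE_apply, hS]; exact hG k hk p.1 p.2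
  have h1 := h (x, t)
  rwa [rotE_apply, hS] at h1

theorem isK'Invariant_fourierT (G : N' → ℂ) (hG : IsK'Invariant G) :
    IsK'Invariant (fourierT G) := by
  rw [isK'Invariant_iff] at hG ⊢
  intro k hk x s
  obtain ⟨S, hS⟩ := exists_isometry_of_sq_eq_one (mem_K'_apply hk).2.2.2.2
  simp only [fourierT]
  rw [← S.measurePreserving.integral_comp S.toHomeomorph.measurableEmbedding]
  congr 1
  ext t
  rw [hS, hG k hk]
  have := (mem_K'_apply hk).2.2.2.2
  have e : k.1 2 2 * t * (k.1 2 2 * s) = t * s := by linear_combination t * s * this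
  simp only [e]

/-! ### Fibre integrals -/

instance isAddHaarMeasure_volume_prod {A B : Type*} [NormedAddCommGroup A] [MeasureSpace A]
    [BorelSpace A] [SecondCountableTopology A] [(volume : Measure A).IsAddHaarMeasure]
    [SFinite (volume : Measure A)] [NormedAddCommGroup B] [MeasureSpace B] [BorelSpace B]
    [SecondCountableTopology B] [(volume : Measure B).IsAddHaarMeasure]
    [SFinite (volume : Measure B)] : (volume : Measure (A × B)).IsAddHaarMeasure :=
  Measure.prod.instIsAddHaarMeasure _ _

theorem integrable_schwartz_prod {A B : Type*} [NormedAddCommGroup A] [NormedSpace ℝ A]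
    [FiniteDimensional ℝ A] [MeasureSpace A] [BorelSpace A]
    [(volume : Measure A).IsAddHaarMeasure] [NormedAddCommGroup B] [NormedSpace ℝ B]
    [FiniteDimensional ℝ B] [MeasureSpace B] [BorelSpace B]
    [(volume : Measure B).IsAddHaarMeasure] (f : 𝓢(A × B, ℂ)) : Integrable f := by
  have : ProperSpace A := FiniteDimensional.proper ℝ A
  have : ProperSpace B := FiniteDimensional.proper ℝ B
  exact f.integrable

/-- `(t, z) ↦ (z₁, z₂, t)`. -/
def assemble : (ℝ × ℝ × ℝ) ≃L[ℝ] E3 :=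
  LinearEquiv.toContinuousLinearEquiv
    { toFun := fun q => !₂[q.2.1, q.2.2, q.1]
      invFun := fun y => (y 2, y 0, y 1)
      left_inv := fun q => by simp
      right_inv := fun y => by ext i; fin_cases i <;> simp
      map_add' := fun p q => by ext i; fin_cases i <;> simp
      map_smul' := fun c q => by ext i; fin_cases i <;> simp }

theorem measurePreserving_assemble : MeasurePreserving assemble := by
  have h1 := (volume_preserving_piFinSuccAbove (fun _ : Fin 3 => ℝ) 2).symm
  have h2 := (MeasurePreserving.id (volume : Measure ℝ)).prod (volume_preserving_finTwoArrow ℝ).symm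
  have h3 := (PiLp.volume_preserving_toLp (Fin 3)).comp (h1.comp h2)
  have e : (assemble : ℝ × ℝ × ℝ → E3) = WithLp.toLp 2 ∘
      (MeasurableEquiv.piFinSuccAbove (fun _ : Fin 3 => ℝ) 2).symm ∘
        Prod.map id MeasurableEquiv.finTwoArrow.symm := by
    ext q i
    fin_cases i <;> rfl
  rw [e]
  exact h3

/-- `((x, t), z) ↦ (x, (z₁, z₂, t))`. -/
def assembleN : (N' × ℝ × ℝ) ≃L[ℝ] N :=
  (ContinuousLinearEquiv.prodAssoc ℝ E3 ℝ (ℝ × ℝ)).trans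
    ((ContinuousLinearEquiv.refl ℝ E3).prodCongr assemble)

theorem assembleN_apply (x : E3) (t : ℝ) (z : ℝ × ℝ) :
    assembleN ((x, t), z) = (x, !₂[z.1, z.2, t]) := rfl

theorem measurePreserving_assembleN : MeasurePreserving assembleN :=
  ((MeasurePreserving.id (volume : Measure E3)).prod measurePreserving_assemble).comp
    (measurePreserving_prodAssoc (volume : Measure E3) (volume : Measure ℝ)
      (volume : Measure (ℝ × ℝ)))

/-- The fibre integral as an operation on Schwartz functions. -/
def fibreIntegralS (F : 𝓢(N, ℂ)) : 𝓢(N', ℂ) :=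
  marginal volume (SchwartzMap.compCLMOfContinuousLinearEquiv ℂ assembleN F)

theorem fibreIntegralS_eq (F : 𝓢(N, ℂ)) : fibreIntegral F = fibreIntegralS F := by
  ext ⟨x, t⟩
  rw [fibreIntegral_apply]
  rfl

/-- The Fourier slice theorem: the character of frequency `(ξ, axis s)` is constant in `y₁, y₂`, so
Fubini integrates these first. -/
theorem prodFT_fibreIntegralS (F : 𝓢(N, ℂ)) (ξ : E3) (s : ℝ) :
    prodFT E3 ℝ (fibreIntegralS F) (ξ, s) = prodFT E3 E3 F (ξ, axis s) := by
  rw [prodFT_apply, prodFT_apply,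
    ← measurePreserving_assembleN.integral_comp assembleN.toHomeomorph.measurableEmbedding]
  set F' := SchwartzMap.compCLMOfContinuousLinearEquiv ℂ assembleN F with hF'
  have hint : Integrable fun q : N' × ℝ × ℝ => F' q *
      Complex.exp (-(Complex.I * ((inner ℝ q.1.1 ξ + inner ℝ q.1.2 s : ℝ) : ℂ))) := by
    have h1 : Integrable F' (volume : Measure (N' × ℝ × ℝ)) := integrable_schwartz_prod F'
    refine h1.mul_bdd (c := 1) (by fun_prop) (Filter.Eventually.of_forall fun q => ?_)
    rw [Complex.norm_exp]
    simp
  have h2 : ∀ q : N' × ℝ × ℝ, F (assembleN q) * Complex.exp (-(Complex.I *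
      ((inner ℝ (assembleN q).1 ξ + inner ℝ (assembleN q).2 (axis s) : ℝ) : ℂ))) = F' q *
      Complex.exp (-(Complex.I * ((inner ℝ q.1.1 ξ + inner ℝ q.1.2 s : ℝ) : ℂ))) := by
    rintro ⟨⟨x, t⟩, z⟩
    have e : inner ℝ (!₂[z.1, z.2, t] : E3) (axis s) = inner ℝ t s := by
      simp [PiLp.inner_apply, Fin.sum_univ_three]
    rw [hF', SchwartzMap.compCLMOfContinuousLinearEquiv_apply, Function.comp_apply, assembleN_apply,
      e]
  simp only [h2]
  rw [Measure.volume_eq_prod N' (ℝ × ℝ)] at hint ⊢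
  rw [integral_prod _ hint]
  congr 1
  ext p
  exact (integral_mul_const _ _).symm

/-! ### Moments -/

theorem iteratedDeriv_fourier_real {φ : ℝ → ℂ} (hφ : ∀ n : ℕ, Integrable fun t : ℝ => t ^ n • φ t)
    (M : ℕ) : iteratedDeriv M (fun s : ℝ => ∫ t : ℝ, φ t *
      Complex.exp (-(Complex.I * ((t * s : ℝ) : ℂ)))) 0 =
      ∫ t : ℝ, (-(Complex.I * (t : ℂ))) ^ M * φ t := by
  have h1 : (fun s : ℝ => ∫ t : ℝ, φ t * Complex.exp (-(Complex.I * ((t * s : ℝ) : ℂ)))) =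
      fun s => 𝓕 φ ((2 * Real.pi)⁻¹ * s) := by
    ext s
    have := fourier_scale φ s
    rw [smul_eq_mul] at this
    rw [this]
    simp [mul_comm]
  have hcd : ContDiff ℝ M (𝓕 φ) := by
    refine Real.contDiff_fourier fun n _ => ?_
    simpa [norm_smul] using (hφ n).norm
  have h2 := congrFun (iteratedDeriv_comp_const_smul hcd (2 * Real.pi)⁻¹) 0
  rw [h1, h2, mul_zero, Real.iteratedDeriv_fourier (N := ⊤) (fun n _ => hφ n) le_top,
    Real.fourier_eq']
  rw [← integral_smul]
  congr 1
  ext t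
  simp only [inner_zero_right, mul_zero, Complex.ofReal_zero, zero_mul, Complex.exp_zero,
    smul_eq_mul, Complex.real_smul]
  push_cast
  rw [one_mul, ← mul_assoc, ← mul_pow]
  congr 2
  have : (Real.pi : ℂ) ≠ 0 := by exact_mod_cast Real.pi_ne_zero
  field_simp

/-- Multiplication by `(-i t)^M`. -/
def mulPow (M : ℕ) : 𝓢(N', ℂ) →L[ℂ] 𝓢(N', ℂ) :=
  SchwartzMap.smulLeftCLM ℂ fun p : N' => (-(Complex.I * (p.2 : ℂ))) ^ M

theorem mulPow_apply (M : ℕ) (G : 𝓢(N', ℂ)) (p : N') :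
    mulPow M G p = (-(Complex.I * (p.2 : ℂ))) ^ M * G p := by
  have h : Function.HasTemperateGrowth fun p : N' => (-(Complex.I * (p.2 : ℂ))) ^ M := by
    refine Function.HasTemperateGrowth.pow ?_ M
    have : (fun p : N' => -(Complex.I * (p.2 : ℂ))) =
        ((-Complex.I) • Complex.ofRealCLM.comp (ContinuousLinearMap.snd ℝ E3 ℝ) : N' →L[ℝ] ℂ) := by
      ext p; simp
    rw [this]
    exact ContinuousLinearMap.hasTemperateGrowth _
  rw [mulPow, SchwartzMap.smulLeftCLM_apply_apply h, smul_eq_mul]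

/-- The `M`-th moment in `t`, divided by `M!`. -/
def moment (M : ℕ) (G : 𝓢(N', ℂ)) : 𝓢(E3, ℂ) :=
  (1 / (M.factorial : ℂ)) • marginal volume (mulPow M G)

theorem moment_apply (M : ℕ) (G : 𝓢(N', ℂ)) (x : E3) : moment M G x =
    (1 / (M.factorial : ℂ)) * ∫ t : ℝ, (-(Complex.I * (t : ℂ))) ^ M * G (x, t) := by
  rw [moment, smul_apply, marginal_apply, smul_eq_mul]
  simp only [mulPow_apply]

theorem integrable_pow_smul (G : 𝓢(N', ℂ)) (n : ℕ) :
    Integrable fun p : N' => (p.2) ^ n • G p := by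
  have h : Integrable (mulPow n G) := integrable_schwartz_prod _
  refine h.mono (by fun_prop) (Filter.Eventually.of_forall fun p => le_of_eq ?_)
  rw [mulPow_apply]
  simp

theorem integrable_pow_smul_section (G : 𝓢(N', ℂ)) (n : ℕ) (x : E3) :
    Integrable fun t : ℝ => t ^ n • G (x, t) := by
  have h := integrable_section volume (mulPow n G) x
  refine h.mono (by fun_prop) (Filter.Eventually.of_forall fun t => le_of_eq ?_)
  rw [mulPow_apply]
  simp

theorem taylorCoeff_fourierT (G : 𝓢(N', ℂ)) (M : ℕ) (x : E3) :
    taylorCoeff (fourierT G) M x = moment M G x := by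
  rw [moment_apply, taylorCoeff]
  congr 1
  exact iteratedDeriv_fourier_real (integrable_pow_smul_section G · x) M

/-- Integrating in `x` first reduces to the moment formula in one variable; a second use of Fubini
recovers the Fourier transform of the moment. -/
theorem taylorCoeff_fourierXT (G : 𝓢(N', ℂ)) (M : ℕ) (ξ : E3) :
    taylorCoeff (fourierXT G) M ξ = angFT E3 (moment M G) ξ := by
  set e : E3 → ℂ := fun x => Complex.exp (-(Complex.I * ((inner ℝ x ξ : ℝ) : ℂ))) with he
  have hen : ∀ x, ‖e x‖ = 1 := fun x => by rw [he, Complex.norm_exp]; simp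
  have hec : Continuous e := by rw [he]; fun_prop
  have hint : ∀ n : ℕ, Integrable fun p : N' => p.2 ^ n • (G p * e p.1) := fun n => by
    refine (integrable_pow_smul G n).mono (by fun_prop)
      (Filter.Eventually.of_forall fun p => le_of_eq ?_)
    simp [hen]
  have hmom : ∀ n : ℕ, Integrable fun t : ℝ => t ^ n • ∫ x, G (x, t) * e x := fun n => by
    have h1 := hint n
    rw [Measure.volume_eq_prod] at h1
    refine h1.integral_prod_right.congr (Filter.Eventually.of_forall fun t => ?_)
    simp only [integral_smul]
  have h1 : (fun s : ℝ => fourierXT G (ξ, s)) = fun s : ℝ => ∫ t : ℝ, (∫ x, G (x, t) * e x) *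
      Complex.exp (-(Complex.I * ((t * s : ℝ) : ℂ))) := by
    ext s
    have h2 : Integrable (fun q : N' => G q * Complex.exp (-(Complex.I * ((inner ℝ q.1 ξ : ℝ) : ℂ)))
        * Complex.exp (-(Complex.I * ((q.2 * s : ℝ) : ℂ)))) := by
      refine (hint 0).mono (by fun_prop) (Filter.Eventually.of_forall fun p => le_of_eq ?_)
      rw [norm_mul, Complex.norm_exp]
      simp [he]
    rw [fourierXT, Measure.volume_eq_prod, integral_prod_symm _ (by
      rwa [← Measure.volume_eq_prod])]
    congr 1
    ext t
    rw [← integral_mul_const]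
  rw [taylorCoeff, h1, iteratedDeriv_fourier_real hmom, angFT_apply]
  simp only [moment_apply]
  have h3 : Integrable (Function.uncurry fun (x : E3) (t : ℝ) =>
      (-(Complex.I * (t : ℂ))) ^ M * (G (x, t) * e x))
      ((volume : Measure E3).prod (volume : Measure ℝ)) := by
    rw [← Measure.volume_eq_prod]
    refine (hint M).mono (Continuous.aestronglyMeasurable (by
      simp only [Function.uncurry_def, Prod.mk.eta]; fun_prop)) (Filter.Eventually.of_forall fun p => le_of_eq ?_)
    simp [Function.uncurry]
  have h4 := integral_integral_swap h3
  simp only [integral_const_mul] at h4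
  rw [← h4, ← integral_const_mul]
  congr 1
  ext x
  rw [mul_assoc, ← integral_mul_const]
  simp only [mul_assoc]
  rfl

/-! ### Radial polynomials and the Fourier transform -/

theorem angFT_rotS (k : SO3) (a : 𝓢(E3, ℂ)) : angFT E3 (rotS k a) = rotS k (angFT E3 a) :=
  SchwartzMap.ext fun ξ => angFT_comp_isometry a (rotE k⁻¹) ξ

/-- With `k` and `t` as parameters the condition becomes a linear identity in `𝓢(E3, ℂ)`, to which
operators commuting with rotations can be applied. -/
theorem isRadialPoly_iff (M : ℕ) (a : 𝓢(E3, ℂ)) : IsRadialPoly M a ↔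
    ∃ c : (Fin 3 → ℕ) → 𝓢(E3, ℂ), ∀ (k : SO3) (t : ℝ),
      (t : ℂ) ^ M • rotS k a = ∑ α ∈ exponents M, monom α (rot k (axis t)) • c α := by
  refine exists_congr fun c => forall_congr' fun k => ?_
  rw [forall_comm]
  refine forall_congr' fun t => ?_
  rw [DFunLike.ext_iff]
  refine forall_congr' fun x => ?_
  rw [smul_apply, rotS_apply, smul_eq_mul, _root_.sum_apply, mul_comm]
  simp only [smul_apply, smul_eq_mul, mul_comm]

theorem isRadialPoly_angFT (M : ℕ) (a : 𝓢(E3, ℂ)) :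
    IsRadialPoly M (angFT E3 a) ↔ IsRadialPoly M a := by
  rw [isRadialPoly_iff, isRadialPoly_iff]
  constructor
  · rintro ⟨c, hc⟩
    choose c' hc' using fun α => angFT_bijective.surjective (c α)
    refine ⟨c', fun k t => angFT_bijective.injective ?_⟩
    rw [map_smul, map_sum, angFT_rotS, hc]
    simp only [map_smul, hc']
  · rintro ⟨c, hc⟩
    refine ⟨fun α => angFT E3 (c α), fun k t => ?_⟩
    rw [← angFT_rotS, ← map_smul, hc, map_sum]
    simp only [map_smul]

theorem propertyR_fourierT_iff (G : 𝓢(N', ℂ)) (hG : IsK'Invariant G) :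
    PropertyR (fourierT G) ↔ ∀ M, IsRadialPoly M (moment M G) := by
  rw [propertyR_iff (isK'Invariant_fourierT G hG)
    fun M => ⟨moment M G, fun x => (taylorCoeff_fourierT G M x).symm⟩]
  refine forall_congr' fun M => ?_
  rw [funext (taylorCoeff_fourierT G M)]

theorem propertyR_fourierXT_iff (G : 𝓢(N', ℂ)) (hG : IsK'Invariant G) :
    PropertyR (fourierXT G) ↔ ∀ M, IsRadialPoly M (taylorCoeff (fourierXT G) M) :=
  propertyR_iff (isK'Invariant_fourierXT G hG)
    fun M => ⟨angFT E3 (moment M G), fun x => (taylorCoeff_fourierXT G M x).symm⟩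

theorem propertyR_fourierT_iff_fourierXT (G : 𝓢(N', ℂ)) (hG : IsK'Invariant G) :
    PropertyR (fourierT G) ↔ PropertyR (fourierXT G) := by
  rw [propertyR_fourierT_iff G hG, propertyR_fourierXT_iff G hG]
  refine forall_congr' fun M => ?_
  rw [funext (taylorCoeff_fourierXT G M), isRadialPoly_angFT]

/-- The fibre integral of a `K`-invariant Schwartz function on `N` corresponds, under the Fourier
transforms, to restriction. -/
theorem exists_fibreIntegral_iff (G : 𝓢(N', ℂ)) :
    (∃ F : 𝓢(N, ℂ), IsKInvariant F ∧ fibreIntegral F = G) ↔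
      ∃ H : 𝓢(N, ℂ), IsKInvariant H ∧ ∀ x t, H (x, axis t) = fourierXT G (x, t) := by
  rw [fourierXT_eq]
  constructor
  · rintro ⟨F, hF, hFG⟩
    rw [fibreIntegralS_eq] at hFG
    have e : fibreIntegralS F = G := DFunLike.coe_injective hFG
    exact ⟨prodFT E3 E3 F, (isKInvariant_prodFT_iff F).2 hF,
      fun x t => by rw [← e, prodFT_fibreIntegralS]⟩
  · rintro ⟨H, hH, h⟩
    obtain ⟨F, rfl⟩ := prodFT_bijective.surjective H
    refine ⟨F, (isKInvariant_prodFT_iff F).1 hH, ?_⟩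
    rw [fibreIntegralS_eq]
    congr 1
    refine prodFT_bijective.injective (SchwartzMap.ext fun ⟨x, t⟩ => ?_)
    rw [prodFT_fibreIntegralS, h]

end FreeNilpotent

/-! ### Taylor polynomials in `y` of invariant functions; necessity of (R). -/

namespace FreeNilpotent

open Finset

section TaylorInY

variable {H : N → ℂ}

theorem iteratedDeriv_line (hH : ContDiff ℝ ∞ H) (M : ℕ) (x y : E3) :
    iteratedDeriv M (fun s : ℝ => H (x, s • y)) 0 =
      iteratedFDeriv ℝ M H (x, 0) fun _ => (0, y) := by
  set L : ℝ →L[ℝ] N := ContinuousLinearMap.toSpanSingleton ℝ ((0 : E3), y) with hL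
  have hH' : ContDiff ℝ ∞ fun q : N => H ((x, 0) + q) := hH.comp (by fun_prop)
  have e : (fun s : ℝ => H (x, s • y)) = (fun q : N => H ((x, 0) + q)) ∘ L := by
    ext s; simp [hL]
  rw [iteratedDeriv_eq_iteratedFDeriv, e,
    L.iteratedFDeriv_comp_right hH' 0 (by exact_mod_cast le_top),
    ContinuousMultilinearMap.compContinuousLinearMap_apply, iteratedFDeriv_comp_add_left]
  simp [hL]

/-- The number of occurrences of each index. -/
def multiplicity {M : ℕ} (r : Fin M → Fin 3) (i : Fin 3) : ℕ := #{m | r m = i}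

theorem multiplicity_mem {M : ℕ} (r : Fin M → Fin 3) : multiplicity r ∈ exponents M := by
  rw [mem_piAntidiag]
  refine ⟨?_, by simp⟩
  have := card_eq_sum_card_fiberwise (s := (univ : Finset (Fin M))) (t := univ) (f := r)
    (fun _ _ => mem_univ _)
  rw [card_univ, Fintype.card_fin] at this
  exact this.symm

theorem prod_apply_eq_monom {M : ℕ} (r : Fin M → Fin 3) (y : E3) :
    ((∏ m, y (r m) : ℝ) : ℂ) = monom (multiplicity r) y := by
  rw [Complex.ofReal_prod, monom, ← prod_fiberwise_of_maps_to' (s := univ) (t := univ) (g := r)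
    (fun _ _ => mem_univ _) fun i => (y i : ℂ)]
  simp [multiplicity, prod_const]

/-- The coefficients of the Taylor polynomials of `H(x, ·)` at `0`. -/
def yCoeff (H : N → ℂ) (M : ℕ) (α : Fin 3 → ℕ) (x : E3) : ℂ :=
  (1 / (M.factorial : ℂ)) * ∑ r : Fin M → Fin 3 with multiplicity r = α,
    iteratedFDeriv ℝ M H (x, 0) fun m => (0, EuclideanSpace.single (r m) 1)

theorem contDiff_yCoeff (hH : ContDiff ℝ ∞ H) (M : ℕ) (α : Fin 3 → ℕ) :
    ContDiff ℝ ∞ (yCoeff H M α) := by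
  refine contDiff_const.mul (ContDiff.sum fun r _ => ?_)
  have h1 : ContDiff ℝ ∞ (iteratedFDeriv ℝ M H) :=
    hH.iteratedFDeriv_right (m := ∞) (by exact_mod_cast le_rfl)
  exact (ContinuousMultilinearMap.apply ℝ (fun _ : Fin M => N) ℂ _).contDiff.comp
    (h1.comp (contDiff_id.prodMk contDiff_const))

theorem iteratedFDeriv_diag_eq_sum (M : ℕ) (x y : E3) :
    (1 / (M.factorial : ℂ)) * (iteratedFDeriv ℝ M H (x, 0) fun _ => (0, y)) =
      ∑ α ∈ exponents M, yCoeff H M α x * monom α y := by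
  have hy : ((0 : E3), y) = ∑ i : Fin 3, y i • ((0 : E3), EuclideanSpace.single i (1 : ℝ)) := by
    refine Prod.ext (by simp [Prod.fst_sum]) ?_
    ext i
    fin_cases i <;> simp [Fin.sum_univ_three]
  -- The multilinear expansion runs over words in the three indices; words with equal multiplicities
  -- share a monomial.
  rw [hy, ContinuousMultilinearMap.map_sum, ← sum_fiberwise_of_maps_to (s := univ)
    (t := exponents M) (g := multiplicity) fun r _ => multiplicity_mem r, mul_sum]
  refine sum_congr rfl fun α _ => ?_
  rw [yCoeff, mul_assoc, sum_mul]
  congr 1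
  refine sum_congr rfl fun r hr => ?_
  rw [ContinuousMultilinearMap.map_smul_univ, ← (mem_filter.1 hr).2, ← prod_apply_eq_monom,
    Complex.real_smul, mul_comm]

/-- Restrictions of smooth `K`-invariant functions have Property (R). -/
theorem propertyR_of_extension (hH : ContDiff ℝ ∞ H) (hK : IsKInvariant H) {g : N' → ℂ}
    (hg : IsK'Invariant g) (h : ∀ x t, H (x, axis t) = g (x, t)) : PropertyR g := by
  intro M
  refine ⟨fun p => ∑ α ∈ exponents M, yCoeff H M α p.1 * monom α p.2, ?_,
    ⟨yCoeff H M, contDiff_yCoeff hH M, fun x y => rfl⟩, fun x y hy => ?_⟩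
  · exact ContDiff.sum fun α _ => ((contDiff_yCoeff hH M α).comp contDiff_fst).mul
      ((contDiff_monom α).comp contDiff_snd)
  · obtain ⟨k, t, ht, -, rfl⟩ := exists_eq_rot_axis hy
    rw [Radial_apply _ (isK'Invariant_taylorTerm hg M) _ _ _ ht, taylorTerm_apply, taylorCoeff]
    -- `K`-invariance turns the third axis over `rot k⁻¹ x` into the line through `rot k (axis 1)`
    -- over `x`, so the `t`-derivatives of `g` become directional derivatives of `H` at `(x, 0)`.
    have h1 : (fun s : ℝ => g (rot k⁻¹ x, s)) = fun s : ℝ => H (x, s • rot k (axis 1)) := by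
      ext s
      have h2 := hK k (rot k⁻¹ x, axis s)
      rw [h] at h2
      rw [← h2, actN]
      simp only [rot_rot_inv]
      rw [← rot_smul, smul_axis, mul_one]
    have h3 : ((0 : E3), rot k (axis t)) = t • ((0 : E3), rot k (axis 1)) := by
      rw [Prod.smul_mk, smul_zero, ← rot_smul, smul_axis, mul_one]
    rw [h1, iteratedDeriv_line hH]
    simp only
    rw [← iteratedFDeriv_diag_eq_sum, h3, ContinuousMultilinearMap.map_smul_univ]
    simp [mul_comm, mul_left_comm]

end TaylorInY

theorem exists_fibreIntegral_iff_propertyR (G : 𝓢(N', ℂ)) (hG : IsK'Invariant G) :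
    (∃ F : 𝓢(N, ℂ), IsKInvariant F ∧ fibreIntegral F = G) ↔ PropertyR (fourierXT G) := by
  rw [exists_fibreIntegral_iff]
  have hi := isK'Invariant_fourierXT G hG
  constructor
  · rintro ⟨H, hK, h⟩
    exact propertyR_of_extension (H.smooth ⊤) hK hi h
  · intro hR
    rw [propertyR_fourierXT_iff G hG] at hR
    rw [fourierXT_eq] at hR hi ⊢
    exact exists_schwartz_extension _ hi hR

end FreeNilpotent

end

open FreeNilpotent
theorem proposition9 (G : 𝓢(N', ℂ)) (hG : IsK'Invariant G) :
    List.TFAE [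
      ∃ F : 𝓢(N, ℂ), IsKInvariant F ∧ fibreIntegral F = G,
      PropertyR (fourierT G),
      PropertyR (fourierXT G)] := by
  tfae_have 1 ↔ 3 := exists_fibreIntegral_iff_propertyR G hG
  tfae_have 2 ↔ 3 := propertyR_fourierT_iff_fourierXT G hG
  tfae_finish
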